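/- Let $0<\gamma\le 1$ and let $\Omega\subset\mathbb C$ be a bounded domain whose boundary is of class $C^{1,\gamma}$, that is, near each point of $\partial\Omega$ there is a real function $\rho$ with $\gamma$-Hölder gradient, not vanishing at that point, such that locally $\Omega=\{\rho<0\}$ and $\partial\Omega=\{\rho=0\}$. Let $g:\mathbb C\to\mathbb C$ belong to $L^p(\mathbb C)$ for some $1<p<\infty$, and suppose that $g|_{\Omega}$ extends to a $\gamma$-Hölder function on $\overline\Omega$ and $g|_{\mathbb C\setminus\overline\Omega}$ extends to a $\gamma$-Hölder function on $\mathbb C\setminus\Omega$. Then the conjugate Beurling transform $$\bar B[g](w)=\lim_{\varepsilon\to0^+}\int_{|\zeta-w|\ge\varepsilon}\frac{g(\zeta)}{(\bar\zeta-\bar w)^2}\,dm(\zeta)$$ ($m$ is Lebesgue measure in the plane) exists at every point $w\in\mathbb C$, the truncated integrals being absolutely convergent. Moreover, for every $z\in\partial\Omega$ both one-sided limits below exist, and $$\bar B[g](z)=\frac12\Bigl\{\lim_{w\to z,\ w\in\Omega}\bar B[g](w)+\lim_{w\to z,\ w\in\mathbb C\setminus\overline\Omega}\bar B[g](w)\Bigr\}.$$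 -/

import Mathlib

open MeasureTheory Filter Topology Set
open scoped NNReal ENNReal ComplexConjugate

/-- The boundary of `Ω` is of class `C^{1,γ}`: near each of its points there is a real defining
function `ρ`, differentiable with `γ`-Hölder differential, whose differential does not vanish at
the point, such that locally `Ω = {ρ < 0}` and `∂Ω = {ρ = 0}`. -/
def HasC1HolderBoundary (γ : ℝ≥0) (Ω : Set ℂ) : Prop :=
  ∀ z ∈ frontier Ω, ∃ (r : ℝ) (ρ : ℂ → ℝ) (K : ℝ≥0), 0 < r ∧
    (∀ w ∈ Metric.ball z r, DifferentiableAt ℝ ρ w) ∧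
    HolderOnWith K γ (fderiv ℝ ρ) (Metric.ball z r) ∧
    fderiv ℝ ρ z ≠ 0 ∧
    (∀ w ∈ Metric.ball z r, w ∈ Ω ↔ ρ w < 0) ∧
    (∀ w ∈ Metric.ball z r, w ∈ frontier Ω ↔ ρ w = 0)

/-- The integrand `g(ζ) / (ζ̄ - z̄)²` of the conjugate Beurling transform at `z`. -/
noncomputable def conjBeurlingIntegrand (g : ℂ → ℂ) (z ζ : ℂ) : ℂ :=
  g ζ / (conj ζ - conj z) ^ 2

/-- The truncated conjugate Beurling transform: the integral of `g(ζ) / (ζ̄ - z̄)²` over the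
complement of the disc of radius `ε` about `z`, with respect to area measure. -/
noncomputable def truncConjBeurling (g : ℂ → ℂ) (ε : ℝ) (z : ℂ) : ℂ :=
  ∫ ζ in (Metric.ball z ε)ᶜ, conjBeurlingIntegrand g z ζ

/-- The conjugate Beurling transform of `g` at `z` exists as a principal value and equals `v`:
all truncated integrals converge absolutely, and they tend to `v` as `ε → 0⁺`. -/
def HasConjBeurling (g : ℂ → ℂ) (z v : ℂ) : Prop :=
  (∀ ε : ℝ, 0 < ε → IntegrableOn (conjBeurlingIntegrand g z) (Metric.ball z ε)ᶜ) ∧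
    Tendsto (fun ε : ℝ => truncConjBeurling g ε z) (𝓝[>] 0) (𝓝 v)

/-- The conjugate Beurling transform as a principal value (meaningful where it exists). -/
noncomputable def conjBeurling (g : ℂ → ℂ) (z : ℂ) : ℂ :=
  limUnder (𝓝[>] (0 : ℝ)) (fun ε : ℝ => truncConjBeurling g ε z)

/-! Off the null set `frontier Ω` one has g = f + h·1_Ω with f and h Hölder on the whole plane. The
integral over |ζ - w| ≥ R is continuous in w, since the kernel is bounded there and decays like
|ζ|⁻², which pairs with L^p. Inside radius R, subtracting the values f(w) and h(w) leaves integrands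
of size O(|u|^{γ-2}), so both copies of `holderPart` are continuous in w. The subtracted f(w)
contributes nothing because the kernel has mean zero on annuli. What remains is h(w) times the
principal value of the kernel over Ω (`hasConjBeurling_of_tendsto`), and this term carries the whole
jump.

Its behaviour is geometric. By evenness of the kernel, a half plane contributes zero on annuli
centred on its edge. At a boundary point the C^{1,γ} condition makes Ω differ from its tangent half
plane only inside a cusp |Re y| ≤ C|y|^{1+γ}, where |y|⁻² is integrable; hence the principal value A
at z exists. For w in Ω near z, let x be a nearest point of the complement, so that w = x - d·n with
n the unit normal at x (`exists_foot`). From w the tangent half plane is Re v < d, and its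
contribution reduces to the strip 0 ≤ Re v < d outside |v| < d, which tends to `stripConst` by
homogeneity. The cusp term passes to the limit under a majorant independent of x and d, because the
pole leaves x along the normal, transversally to the cusp (`norm_cuspIntegrand_le`). The limit from
inside is therefore A + n²·`stripConst`, with n now the normal at z.

The same argument on the exterior, with -ρ in place of ρ, has normal -n and the same n². The kernel
integral over the exterior is minus that over Ω, so the limit from outside is A - n²·`stripConst`.
The average is A, and the value of `stripConst` is never needed. -/

/-- A Hölder function on a subset of `ℂ` extends to a Hölder function on `ℂ`. -/
theorem HolderOnWith.exists_extension {γ C : ℝ≥0} (hγ₀ : 0 < γ) (hγ₁ : γ ≤ 1) {s : Set ℂ}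
    {f : ℂ → ℂ} (hf : HolderOnWith C γ f s) :
    ∃ (F : ℂ → ℂ) (D : ℝ), 0 ≤ D ∧ (∀ x y, ‖F x - F y‖ ≤ D * ‖x - y‖ ^ (γ : ℝ)) ∧ EqOn f F s := by
  have hγ₀' : (0 : ℝ) < γ := by exact_mod_cast hγ₀
  have hγ₁' : (γ : ℝ) ≤ 1 := by exact_mod_cast hγ₁
  -- For the snowflake metric |x - y|^γ, Hölder means Lipschitz, so Lipschitz extension into a
  -- finite-dimensional space applies.
  let T := Metric.Snowflaking ℂ (γ : ℝ) hγ₀' hγ₁'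
  have h1 : LipschitzOnWith C (fun x : T => f x.ofSnowflaking)
      (Metric.Snowflaking.ofSnowflaking ⁻¹' s) := by
    intro x hx y hy
    have := hf _ hx _ hy
    rw [Metric.Snowflaking.edist_def]
    exact this
  obtain ⟨F, hF, hFs⟩ := h1.extend_finite_dimension
  refine ⟨fun x => F (Metric.Snowflaking.toSnowflaking x),
    (lipschitzExtensionConstant ℂ * C : ℝ≥0), NNReal.coe_nonneg _, fun x y => ?_, fun x hx => ?_⟩
  · have := hF.dist_le_mul (Metric.Snowflaking.toSnowflaking x) (Metric.Snowflaking.toSnowflaking y)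
    rw [Metric.Snowflaking.dist_toSnowflaking_toSnowflaking, dist_eq_norm, dist_eq_norm] at this
    exact this
  · have := hFs (x := Metric.Snowflaking.toSnowflaking x) (by simpa using hx)
    simpa using this

/-! ### The kernel: symmetries and cancellation on annuli. -/

/-- The convolution kernel `1 / ū²` of the conjugate Beurling transform. -/
noncomputable def conjKernel (u : ℂ) : ℂ := (conj u ^ 2)⁻¹

theorem norm_conjKernel (u : ℂ) : ‖conjKernel u‖ = (‖u‖ ^ 2)⁻¹ := by
  simp [conjKernel]

theorem measurable_conjKernel : Measurable conjKernel := by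
  unfold conjKernel
  exact ((Complex.continuous_conj.pow 2).measurable).inv

theorem continuousAt_conjKernel {u : ℂ} (hu : u ≠ 0) : ContinuousAt conjKernel u := by
  unfold conjKernel
  refine ContinuousAt.inv₀ (by fun_prop) ?_
  simpa using hu

theorem conjKernel_mul (a u : ℂ) : conjKernel (a * u) = conjKernel a * conjKernel u := by
  simp [conjKernel, mul_pow, mul_comm]

theorem conjKernel_of_norm_eq_one {a : ℂ} (ha : ‖a‖ = 1) : conjKernel a = a ^ 2 := by
  have h : a * conj a = 1 := by rw [Complex.mul_conj, Complex.normSq_eq_norm_sq, ha]; simp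
  rw [conjKernel, ← inv_pow, inv_eq_of_mul_eq_one_left h]

theorem conjKernel_neg (u : ℂ) : conjKernel (-u) = conjKernel u := by
  simp [conjKernel]

theorem measurePreserving_mul_of_norm_eq_one {a : ℂ} (ha : ‖a‖ = 1) :
    MeasurePreserving (fun u : ℂ => a * u) := by
  have := (rotation ⟨a, by simpa [Submonoid.unitSphere] using ha⟩).measurePreserving
  exact this

theorem integral_comp_mul_of_norm_eq_one {a : ℂ} (ha : ‖a‖ = 1) (f : ℂ → ℂ) :
    ∫ u, f (a * u) = ∫ u, f u := by
  have h0 : a ≠ 0 := by rintro rfl; simp at ha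
  exact (measurePreserving_mul_of_norm_eq_one ha).integral_comp
    (Homeomorph.mulLeft₀ a h0).measurableEmbedding f

/-- The half-open annulus `ε ≤ |u| < R`. -/
def annulus (ε R : ℝ) : Set ℂ := {u | ε ≤ ‖u‖ ∧ ‖u‖ < R}

theorem measurableSet_annulus (ε R : ℝ) : MeasurableSet (annulus ε R) :=
  (measurableSet_le measurable_const measurable_norm).inter
    (measurableSet_lt measurable_norm measurable_const)

theorem volume_annulus_lt_top (ε R : ℝ) : volume (annulus ε R) < ∞ :=
  (measure_mono (fun u hu => by simpa using hu.2)).trans_lt (measure_ball_lt_top (x := (0:ℂ)) (r := R))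

theorem setIntegral_annulus_comp_mul {a : ℂ} (ha : ‖a‖ = 1) (f : ℂ → ℂ) (ε R : ℝ) :
    ∫ u in annulus ε R, f (a * u) = ∫ u in annulus ε R, f u := by
  rw [← integral_indicator (measurableSet_annulus ε R),
    ← integral_indicator (measurableSet_annulus ε R),
    ← integral_comp_mul_of_norm_eq_one ha ((annulus ε R).indicator f)]
  congr 1 with u
  by_cases h : ε ≤ ‖u‖ ∧ ‖u‖ < R <;> simp [indicator, annulus, ha, h]

/-- A bounded measurable function times the kernel is integrable on annuli. -/
theorem integrableOn_annulus_mul_conjKernel {ε R M : ℝ} (hε : 0 < ε) {f : ℂ → ℂ}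
    (hf : AEStronglyMeasurable f (volume.restrict (annulus ε R)))
    (hM : ∀ u ∈ annulus ε R, ‖f u‖ ≤ M) :
    IntegrableOn (fun u => f u * conjKernel u) (annulus ε R) := by
  have : IsFiniteMeasure (volume.restrict (annulus ε R)) := ⟨by simpa using volume_annulus_lt_top ε R⟩
  refine Integrable.of_bound (hf.mul measurable_conjKernel.aestronglyMeasurable)
    (M * (ε ^ 2)⁻¹) ?_
  filter_upwards [ae_restrict_mem (measurableSet_annulus ε R)] with u hu
  rw [norm_mul, norm_conjKernel]
  have h1 : (‖u‖ ^ 2)⁻¹ ≤ (ε ^ 2)⁻¹ := by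
    have := hu.1
    gcongr
  exact mul_le_mul (hM u hu) h1 (by positivity) ((norm_nonneg _).trans (hM u hu))

/-- Rotation by i preserves the annulus and multiplies the kernel by i² = -1. -/
theorem setIntegral_annulus_conjKernel (ε R : ℝ) : ∫ u in annulus ε R, conjKernel u = 0 := by
  have h := setIntegral_annulus_comp_mul (a := Complex.I) (by simp) conjKernel ε R
  simp_rw [conjKernel_mul, conjKernel_of_norm_eq_one (a := Complex.I) (by simp)] at h
  simp only [Complex.I_sq, neg_mul, one_mul, integral_neg] at h
  exact self_eq_neg.mp h.symm

theorem volume_re_eq (c : ℝ) : volume {u : ℂ | u.re = c} = 0 := by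
  have h : {u : ℂ | u.re = c} = Complex.measurableEquivRealProd ⁻¹' ({c} ×ˢ univ) := by
    ext u; simp [Complex.measurableEquivRealProd_apply]
  rw [h, Complex.volume_preserving_equiv_real_prod.measure_preimage
    ((measurableSet_singleton c).prod MeasurableSet.univ).nullMeasurableSet]
  simp [Measure.volume_eq_prod]

theorem volume_im_eq (c : ℝ) : volume {u : ℂ | u.im = c} = 0 := by
  have h : {u : ℂ | u.im = c} = Complex.measurableEquivRealProd ⁻¹' (univ ×ˢ {c}) := by
    ext u; simp [Complex.measurableEquivRealProd_apply]
  rw [h, Complex.volume_preserving_equiv_real_prod.measure_preimage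
    (MeasurableSet.univ.prod (measurableSet_singleton c)).nullMeasurableSet]
  simp [Measure.volume_eq_prod]

/-- The kernel is even, so u ↦ -u gives the two half planes equal integrals; together they make up
the full annulus integral, which is zero. -/
theorem setIntegral_annulus_halfPlane_conjKernel {ε : ℝ} (hε : 0 < ε) (R : ℝ) :
    ∫ u in annulus ε R, {v : ℂ | v.re < 0}.indicator 1 u * conjKernel u = 0 := by
  have hm : MeasurableSet {v : ℂ | v.re < 0} := measurableSet_lt Complex.measurable_re measurable_const
  have hm' : MeasurableSet {v : ℂ | (-v).re < 0} :=
    measurableSet_lt (Complex.measurable_re.comp measurable_neg) measurable_const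
  have h := setIntegral_annulus_comp_mul (a := -1) (by simp)
    (fun u => {v : ℂ | v.re < 0}.indicator 1 u * conjKernel u) ε R
  simp only [neg_mul, one_mul, conjKernel_neg] at h
  have h2 : ∫ u in annulus ε R, ({v : ℂ | v.re < 0}.indicator 1 u * conjKernel u +
      {v : ℂ | v.re < 0}.indicator 1 (-u) * conjKernel u) = 0 := by
    rw [← setIntegral_annulus_conjKernel ε R]
    refine integral_congr_ae (ae_restrict_of_ae ?_)
    have : ∀ᵐ u : ℂ, u.re ≠ 0 := by
      rw [ae_iff]; simpa using volume_re_eq 0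
    filter_upwards [this] with u hu
    rcases lt_or_gt_of_ne hu with h | h
    · simp [indicator, h, h.le]
    · simp [indicator, h, h.le]
  rw [integral_add, h] at h2
  · exact self_eq_neg.mp (eq_neg_of_add_eq_zero_left h2)
  · refine integrableOn_annulus_mul_conjKernel (M := 1) hε
      ((measurable_one.indicator hm).aestronglyMeasurable) fun u _ => ?_
    exact (norm_indicator_le_norm_self _ _).trans (by simp)
  · refine integrableOn_annulus_mul_conjKernel (M := 1) hε
      (((measurable_one.indicator hm).comp measurable_neg).aestronglyMeasurable) fun u _ => ?_
    exact (norm_indicator_le_norm_self _ _).trans (by simp)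

/-! ### Absolute integrability of the singular majorants. -/

/-- Products of integrable functions of the real and imaginary part are integrable. -/
theorem integrable_re_mul_im {f g : ℝ → ℝ} (hf : Integrable f) (hg : Integrable g) :
    Integrable (fun u : ℂ => f u.re * g u.im) := by
  have h := hf.mul_prod hg
  exact (Complex.volume_preserving_equiv_real_prod.integrable_comp_emb
    Complex.measurableEquivRealProd.measurableEmbedding).mpr h

theorem integrable_indicator_abs_rpow {a : ℝ} (ha : a < 1) (M : ℝ) :
    Integrable ((Ioo (-M) M).indicator fun x : ℝ => |x| ^ (-a)) := by
  rw [integrable_indicator_iff measurableSet_Ioo]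
  rcases le_or_gt M 0 with hM | hM
  · rw [Ioo_eq_empty (by linarith)]; exact integrableOn_empty
  have h1 : IntegrableOn (fun x : ℝ => |x| ^ (-a)) (Ioc 0 M) := by
    have := (intervalIntegral.intervalIntegrable_rpow' (a := 0) (b := M) (r := -a) (by linarith))
    rw [intervalIntegrable_iff_integrableOn_Ioc_of_le hM.le] at this
    refine this.congr_fun (fun x hx => ?_) measurableSet_Ioc
    simp only [abs_of_pos hx.1]
  have h2 : IntegrableOn (fun x : ℝ => |x| ^ (-a)) (Ico (-M) 0) := by
    have := h1.comp_neg
    simpa using this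
  have h3 : IntegrableOn (fun x : ℝ => |x| ^ (-a)) {0} := integrableOn_singleton (by simp) (by simp)
  refine (h2.union (h1.union h3)).mono_set fun x hx => ?_
  rcases lt_trichotomy x 0 with h | h | h
  · exact Or.inl ⟨hx.1.le, h⟩
  · exact Or.inr (Or.inr h)
  · exact Or.inr (Or.inl ⟨h, hx.2.le⟩)

/-- A majorant `|Re u|⁻ᵃ |Im u|⁻ᵇ` on a bounded set gives integrability. -/
theorem integrable_of_le_re_im_rpow {f : ℂ → ℝ} {a b D M : ℝ} (ha : a < 1) (hb : b < 1)
    (hfm : AEStronglyMeasurable f) (hsupp : ∀ u, M ≤ ‖u‖ → f u = 0) (hD : 0 ≤ D)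
    (hf : ∀ u : ℂ, u.re ≠ 0 → u.im ≠ 0 → ‖f u‖ ≤ D * (|u.re| ^ (-a) * |u.im| ^ (-b))) :
    Integrable f := by
  refine ((integrable_re_mul_im (integrable_indicator_abs_rpow ha M)
    (integrable_indicator_abs_rpow hb M)).const_mul D).mono' hfm ?_
  have h1 : ∀ᵐ u : ℂ, u.re ≠ 0 := by rw [ae_iff]; simpa using volume_re_eq 0
  have h2 : ∀ᵐ u : ℂ, u.im ≠ 0 := by rw [ae_iff]; simpa using volume_im_eq 0
  filter_upwards [h1, h2] with u hr hi
  by_cases hu : ‖u‖ < M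
  · rw [indicator_of_mem, indicator_of_mem]
    · exact hf u hr hi
    · exact abs_lt.mp ((Complex.abs_im_le_norm u).trans_lt hu)
    · exact abs_lt.mp ((Complex.abs_re_le_norm u).trans_lt hu)
  · rw [hsupp u (not_lt.mp hu), norm_zero]
    refine mul_nonneg hD (mul_nonneg ?_ ?_) <;>
    exact indicator_nonneg (fun _ _ => by positivity) _

/-- `|u|^{γ-2}` is integrable on discs. -/
theorem integrable_indicator_norm_rpow {γ : ℝ} (hγ : 0 < γ) (hγ₁ : γ ≤ 1) (R : ℝ) :
    Integrable ((Metric.ball (0 : ℂ) R).indicator fun u => ‖u‖ ^ γ * (‖u‖ ^ 2)⁻¹) := by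
  have hm : Measurable fun u : ℂ => ‖u‖ ^ γ * (‖u‖ ^ 2)⁻¹ := by fun_prop
  -- The exponent γ - 2 is split evenly between |Re u| and |Im u|, both at most |u|; each half
  -- exceeds -1.
  refine integrable_of_le_re_im_rpow (a := 1 - γ / 2) (b := 1 - γ / 2) (D := 1) (M := R)
    (by linarith) (by linarith) ((hm.indicator measurableSet_ball).aestronglyMeasurable)
    (fun u hu => indicator_of_notMem (by simpa using hu) _) zero_le_one fun u hr hi => ?_
  refine (norm_indicator_le_norm_self _ _).trans ?_
  have hu : 0 < ‖u‖ := norm_pos_iff.mpr fun h => hr (by simp [h])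
  rw [Real.norm_of_nonneg (by positivity), one_mul]
  have : ‖u‖ ^ γ * (‖u‖ ^ 2)⁻¹ = ‖u‖ ^ (-(1 - γ / 2)) * ‖u‖ ^ (-(1 - γ / 2)) := by
    rw [← Real.rpow_natCast, ← Real.rpow_neg hu.le, ← Real.rpow_add hu, ← Real.rpow_add hu]
    congr 1; push_cast; ring
  rw [this]
  gcongr ?_ * ?_
  · exact Real.rpow_le_rpow_of_nonpos (abs_pos.mpr hr) (Complex.abs_re_le_norm u) (by linarith)
  · exact Real.rpow_le_rpow_of_nonpos (abs_pos.mpr hi) (Complex.abs_im_le_norm u) (by linarith)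

/-- The cusp `|Re y| ≤ C |y|^{1+γ}`, `|y| < M`. -/
def cusp (C γ M : ℝ) : Set ℂ := {y | |y.re| ≤ C * ‖y‖ ^ (1 + γ) ∧ ‖y‖ < M}

theorem measurableSet_cusp (C γ M : ℝ) : MeasurableSet (cusp C γ M) :=
  (measurableSet_le (f := fun y : ℂ => |y.re|) (g := fun y : ℂ => C * ‖y‖ ^ (1 + γ))
    (Complex.measurable_re.abs) (by fun_prop)).inter
    (measurableSet_lt measurable_norm measurable_const)

/-- The kernel is absolutely integrable on cusps. -/
theorem integrable_indicator_cusp {γ C : ℝ} (hγ : 0 < γ) (hγ₁ : γ ≤ 1) (hC : 0 ≤ C) (M : ℝ) :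
    Integrable ((cusp C γ M).indicator fun u => (‖u‖ ^ 2)⁻¹) := by
  have hm : Measurable fun u : ℂ => (‖u‖ ^ 2)⁻¹ := by fun_prop
  -- On the cusp, |Re u|^a ≤ C^a |u|^{(1+γ)a} trades part of |u|⁻² for |Re u|^{-a}, leaving
  -- |u|^{-(2-(1+γ)a)}. Both exponents are admissible exactly when 1/(1+γ) < a < 1.
  obtain ⟨a, ha0, ha⟩ := exists_between (show 1 / (1 + γ) < 1 by
    rw [div_lt_one (by linarith)]; linarith)
  have ha1 : 1 < (1 + γ) * a := by
    rwa [div_lt_iff₀ (by linarith), mul_comm] at ha0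
  have hapos : 0 < a := lt_trans (by positivity) ha0
  refine integrable_of_le_re_im_rpow (a := a) (b := 2 - (1 + γ) * a) (D := C ^ a) (M := M)
    ha (by linarith) ((hm.indicator (measurableSet_cusp C γ M)).aestronglyMeasurable)
    (fun u hu => indicator_of_notMem (fun h => absurd h.2 (not_lt.mpr hu)) _) (by positivity)
    fun u hr hi => ?_
  have hu : 0 < ‖u‖ := norm_pos_iff.mpr fun h => hr (by simp [h])
  have hr' : 0 < |u.re| := abs_pos.mpr hr
  by_cases hcu : u ∈ cusp C γ M
  · rw [indicator_of_mem hcu, Real.norm_of_nonneg (by positivity)]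
    have h1 : |u.re| ^ a ≤ C ^ a * ‖u‖ ^ ((1 + γ) * a) := by
      rw [Real.rpow_mul hu.le, ← Real.mul_rpow hC (by positivity)]
      exact Real.rpow_le_rpow hr'.le hcu.1 hapos.le
    have h2 : ‖u‖ ^ (-(2 - (1 + γ) * a)) ≤ |u.im| ^ (-(2 - (1 + γ) * a)) :=
      Real.rpow_le_rpow_of_nonpos (abs_pos.mpr hi) (Complex.abs_im_le_norm u) (by nlinarith)
    have h3 : (‖u‖ ^ 2)⁻¹ = ‖u‖ ^ (-(2 - (1 + γ) * a)) * (‖u‖ ^ ((1 + γ) * a))⁻¹ := by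
      rw [← Real.rpow_natCast, ← Real.rpow_neg hu.le, ← Real.rpow_neg hu.le, ← Real.rpow_add hu]
      congr 1; push_cast; ring
    have h4 : (‖u‖ ^ ((1 + γ) * a))⁻¹ ≤ C ^ a * |u.re| ^ (-a) := by
      rw [Real.rpow_neg hr'.le, ← div_eq_mul_inv, le_div_iff₀ (by positivity),
        inv_mul_le_iff₀ (by positivity), mul_comm]
      exact h1
    rw [h3]
    calc _ ≤ |u.im| ^ (-(2 - (1 + γ) * a)) * (C ^ a * |u.re| ^ (-a)) :=
          mul_le_mul h2 h4 (by positivity) (by positivity)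
      _ = _ := by ring
  · rw [indicator_of_notMem hcu, norm_zero]; positivity

/-! ### Half planes and strips: the source of the jump. -/

theorem annulus_union {ε δ R : ℝ} (h₁ : ε ≤ δ) (h₂ : δ ≤ R) :
    annulus ε δ ∪ annulus δ R = annulus ε R := by
  ext u
  simp only [annulus, mem_union, mem_ofPred_eq]
  constructor
  · rintro (h | h)
    · exact ⟨h.1, h.2.trans_le h₂⟩
    · exact ⟨h₁.trans h.1, h.2⟩
  · rintro h
    rcases lt_or_ge ‖u‖ δ with h' | h'
    · exact Or.inl ⟨h.1, h'⟩
    · exact Or.inr ⟨h', h.2⟩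

theorem disjoint_annulus (ε δ R : ℝ) : Disjoint (annulus ε δ) (annulus δ R) :=
  Set.disjoint_left.mpr fun _ h h' => absurd h.2 (not_lt.mpr h'.1)

theorem setIntegral_annulus_split {ε δ R : ℝ} (h₁ : ε ≤ δ) (h₂ : δ ≤ R) {f : ℂ → ℂ}
    (hf : IntegrableOn f (annulus ε R)) :
    ∫ u in annulus ε R, f u = (∫ u in annulus ε δ, f u) + ∫ u in annulus δ R, f u := by
  rw [← annulus_union h₁ h₂] at hf ⊢
  exact setIntegral_union (disjoint_annulus ε δ R) (measurableSet_annulus δ R)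
    hf.left_of_union hf.right_of_union

/-- Indicator functions times the kernel are integrable on annuli. -/
theorem integrableOn_annulus_indicator {ε : ℝ} (hε : 0 < ε) (R : ℝ) {s : Set ℂ}
    (hs : MeasurableSet s) :
    IntegrableOn (fun u => s.indicator 1 u * conjKernel u) (annulus ε R) :=
  integrableOn_annulus_mul_conjKernel (M := 1) hε
    ((measurable_one.indicator hs).aestronglyMeasurable)
    fun u _ => (norm_indicator_le_norm_self _ _).trans (by simp)

/-- The vertical strip `0 ≤ Re u < d`. -/
def strip (d : ℝ) : Set ℂ := {u | 0 ≤ u.re ∧ u.re < d}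

theorem measurableSet_strip (d : ℝ) : MeasurableSet (strip d) :=
  (measurableSet_le measurable_const Complex.measurable_re).inter
    (measurableSet_lt Complex.measurable_re measurable_const)

theorem measurableSet_re_lt (d : ℝ) : MeasurableSet {u : ℂ | u.re < d} :=
  measurableSet_lt Complex.measurable_re measurable_const

/-- For |u| < d the half plane Re u < d contains the whole annulus, which integrates to zero. For
|u| ≥ d it is the left half plane, again contributing zero, plus the strip. -/
theorem setIntegral_annulus_re_lt {ε d R : ℝ} (hε : 0 < ε) (hd : ε ≤ d) (hR : d ≤ R) :
    ∫ u in annulus ε R, {v : ℂ | v.re < d}.indicator 1 u * conjKernel u =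
      ∫ u in annulus d R, (strip d).indicator 1 u * conjKernel u := by
  have hd0 := hε.trans_le hd
  rw [setIntegral_annulus_split hd hR (integrableOn_annulus_indicator hε R (measurableSet_re_lt d))]
  have h1 : ∫ u in annulus ε d, {v : ℂ | v.re < d}.indicator 1 u * conjKernel u = 0 := by
    rw [← setIntegral_annulus_conjKernel ε d]
    refine setIntegral_congr_fun (measurableSet_annulus ε d) fun u hu => ?_
    have : u.re < d := (Complex.re_le_norm u).trans_lt hu.2
    simp [indicator, this]
  have h2 : ∀ u : ℂ, {v : ℂ | v.re < d}.indicator 1 u * conjKernel u =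
      {v : ℂ | v.re < 0}.indicator 1 u * conjKernel u + (strip d).indicator 1 u * conjKernel u := by
    intro u
    rcases lt_or_ge u.re 0 with h | h
    · simp [indicator, strip, h, h.trans hd0]
    · simp [indicator, strip, h, not_lt.mpr h]
  rw [h1, zero_add]
  simp_rw [h2]
  rw [integral_add (integrableOn_annulus_indicator hd0 R (measurableSet_re_lt 0))
    (integrableOn_annulus_indicator hd0 R (measurableSet_strip d)),
    setIntegral_annulus_halfPlane_conjKernel hd0, zero_add]

/-- The integral of the kernel over the part of the strip `0 ≤ Re u < 1` outside the unit disc; it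
is half the jump of the transform of a half plane. -/
noncomputable def stripConst : ℂ :=
  ∫ t, {t : ℂ | 1 ≤ ‖t‖ ∧ t ∈ strip 1}.indicator conjKernel t

theorem integrable_strip_majorant :
    Integrable fun u : ℂ => (Ico (0 : ℝ) 1).indicator 1 u.re * (2 * (1 + u.im ^ 2)⁻¹) := by
  refine integrable_re_mul_im (f := (Ico (0 : ℝ) 1).indicator 1) ?_
    (integrable_inv_one_add_sq.const_mul 2)
  rw [integrable_indicator_iff measurableSet_Ico]
  exact integrableOn_const (by simp)

/-- The kernel is homogeneous of degree -2, which cancels the area factor of u = d·t. The domain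
becomes the fixed unit strip with 1 ≤ |t| < R/d, and the outer radius goes to infinity. -/
theorem tendsto_setIntegral_strip {R : ℝ} (hR : 0 < R) :
    Tendsto (fun d : ℝ => ∫ u in annulus d R, (strip d).indicator 1 u * conjKernel u) (𝓝[>] 0)
      (𝓝 stripConst) := by
  have hscale : ∀ d : ℝ, 0 < d → ∫ u in annulus d R, (strip d).indicator 1 u * conjKernel u =
      ∫ t, (annulus 1 (R / d) ∩ strip 1).indicator conjKernel t := by
    intro d hd
    rw [← integral_indicator (measurableSet_annulus d R)]
    have h := Measure.integral_comp_smul (volume : Measure ℂ)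
      ((annulus d R).indicator fun u => (strip d).indicator 1 u * conjKernel u) d
    have h2 : ∀ t : ℂ, (annulus d R).indicator
        (fun u => (strip d).indicator 1 u * conjKernel u) (d • t) =
        ((d ^ 2)⁻¹ : ℝ) • (annulus 1 (R / d) ∩ strip 1).indicator conjKernel t := by
      intro t
      have e1 : d • t ∈ annulus d R ↔ t ∈ annulus 1 (R / d) := by
        simp only [annulus, mem_ofPred_eq, norm_smul, Real.norm_of_nonneg hd.le, lt_div_iff₀ hd]
        rw [le_mul_iff_one_le_right hd, mul_comm]
      have e2 : d • t ∈ strip d ↔ t ∈ strip 1 := by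
        simp only [strip, mem_ofPred_eq, Complex.smul_re, smul_eq_mul]
        rw [mul_nonneg_iff_of_pos_left hd, mul_lt_iff_lt_one_right hd]
      have e3 : conjKernel (d • t) = ((d ^ 2)⁻¹ : ℝ) • conjKernel t := by
        rw [Complex.real_smul, conjKernel_mul, Complex.real_smul]
        simp [conjKernel]
      by_cases c1 : t ∈ annulus 1 (R / d) <;> by_cases c2 : t ∈ strip 1 <;>
        simp [indicator, -Complex.real_smul, e1, e2, e3, c1, c2]
    simp_rw [h2] at h
    rw [integral_smul, Complex.finrank_real_complex, abs_of_pos (by positivity)] at h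
    exact (smul_right_injective ℂ (by positivity : ((d ^ 2)⁻¹ : ℝ) ≠ 0) h).symm
  refine Tendsto.congr' (f₁ := fun d => ∫ t, (annulus 1 (R / d) ∩ strip 1).indicator conjKernel t)
    ?_ ?_
  · filter_upwards [self_mem_nhdsWithin] with d hd
    exact (hscale d hd).symm
  refine tendsto_integral_filter_of_dominated_convergence _ ?_ ?_ integrable_strip_majorant ?_
  · exact Eventually.of_forall fun d => (measurable_conjKernel.indicator
      ((measurableSet_annulus _ _).inter (measurableSet_strip 1))).aestronglyMeasurable
  · refine Eventually.of_forall fun d => Eventually.of_forall fun t => ?_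
    by_cases ht : t ∈ annulus 1 (R / d) ∩ strip 1
    · rw [indicator_of_mem ht, norm_conjKernel, indicator_of_mem (show t.re ∈ Ico (0 : ℝ) 1 from ht.2)]
      simp only [Pi.one_apply, one_mul]
      have h1 : 1 ≤ ‖t‖ := ht.1.1
      have h2 : ‖t‖ ^ 2 = t.re ^ 2 + t.im ^ 2 := by
        rw [← Complex.normSq_eq_norm_sq, Complex.normSq_apply]; ring
      rw [← div_eq_mul_inv, inv_eq_one_div, div_le_div_iff₀ (by positivity) (by positivity)]
      nlinarith [sq_nonneg t.re]
    · rw [indicator_of_notMem ht, norm_zero]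
      exact mul_nonneg (indicator_nonneg (fun _ _ => zero_le_one) _) (by positivity)
  · refine Eventually.of_forall fun t => ?_
    refine tendsto_const_nhds.congr' ?_
    have h : Tendsto (fun d : ℝ => R / d) (𝓝[>] 0) atTop :=
      Tendsto.const_mul_atTop hR tendsto_inv_nhdsGT_zero
    filter_upwards [h.eventually_gt_atTop ‖t‖] with d hd
    by_cases c1 : 1 ≤ ‖t‖ <;> by_cases c2 : t ∈ strip 1 <;> simp [indicator, annulus, c1, c2, hd]

/-! ### Normals and local geometry of a C^{1,γ} boundary. -/

/-- The gradient of a real linear functional on `ℂ`, as a complex number. -/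
noncomputable def complexGradient (L : ℂ →L[ℝ] ℝ) : ℂ := ⟨L 1, L Complex.I⟩

theorem apply_eq_re_conj_complexGradient (L : ℂ →L[ℝ] ℝ) (y : ℂ) :
    L y = (conj (complexGradient L) * y).re := by
  have h : y = y.re • (1 : ℂ) + y.im • Complex.I := by
    apply Complex.ext <;> simp
  conv_lhs => rw [h]
  rw [map_add, map_smul, map_smul]
  simp [complexGradient]
  ring

theorem continuous_complexGradient : Continuous complexGradient := by
  have h : complexGradient = fun L => (L 1 : ℂ) + (L Complex.I : ℂ) * Complex.I := by
    ext L; apply Complex.ext <;> simp [complexGradient]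
  rw [h]
  fun_prop

theorem complexGradient_ne_zero {L : ℂ →L[ℝ] ℝ} (hL : L ≠ 0) : complexGradient L ≠ 0 := by
  intro h
  apply hL
  ext y
  simp [apply_eq_re_conj_complexGradient, h]

theorem complexGradient_neg (L : ℂ →L[ℝ] ℝ) : complexGradient (-L) = -complexGradient L := by
  apply Complex.ext <;> simp [complexGradient]

/-- The unit vector in the direction of the gradient of `ρ` at `x`. -/
noncomputable def unitNormal (ρ : ℂ → ℝ) (x : ℂ) : ℂ :=
  complexGradient (fderiv ℝ ρ x) / ‖complexGradient (fderiv ℝ ρ x)‖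

theorem unitNormal_neg (ρ : ℂ → ℝ) (x : ℂ) : unitNormal (fun w => -ρ w) x = -unitNormal ρ x := by
  have : fderiv ℝ (fun w => -ρ w) x = -fderiv ℝ ρ x := fderiv_fun_neg
  rw [unitNormal, unitNormal, this, complexGradient_neg, norm_neg, neg_div]

theorem norm_unitNormal {ρ : ℂ → ℝ} {x : ℂ} (h : complexGradient (fderiv ℝ ρ x) ≠ 0) :
    ‖unitNormal ρ x‖ = 1 := by
  rw [unitNormal, norm_div, Complex.norm_real, norm_norm, div_self (norm_ne_zero_iff.mpr h)]

theorem conj_complexGradient_mul_unitNormal (ρ : ℂ → ℝ) (x : ℂ) :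
    conj (complexGradient (fderiv ℝ ρ x)) * unitNormal ρ x = ‖complexGradient (fderiv ℝ ρ x)‖ := by
  set N := complexGradient (fderiv ℝ ρ x) with hN
  rcases eq_or_ne N 0 with h | h
  · simp [h]
  · have h' : (‖N‖ : ℂ) ≠ 0 := by exact_mod_cast norm_ne_zero_iff.mpr h
    rw [unitNormal, ← hN, ← mul_div_assoc, mul_comm, Complex.mul_conj, Complex.normSq_eq_norm_sq]
    field_simp
    push_cast
    ring

/-- In the frame of the unit normal the linear part of ρ depends on Re y alone, so its negative side
is the left half plane. -/
theorem fderiv_apply_unitNormal_mul (ρ : ℂ → ℝ) (x y : ℂ) :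
    fderiv ℝ ρ x (unitNormal ρ x * y) = ‖complexGradient (fderiv ℝ ρ x)‖ * y.re := by
  rw [apply_eq_re_conj_complexGradient, ← mul_assoc, conj_complexGradient_mul_unitNormal,
    Complex.re_ofReal_mul]

/-- `ρ` is a `C^{1,γ}` defining function of `U` in the disc of radius `r` about its zero `z`. -/
structure IsLocalDefiningFunction (γ : ℝ≥0) (U : Set ℂ) (z : ℂ) (r : ℝ) (ρ : ℂ → ℝ) (K : ℝ≥0) :
    Prop where
  pos : 0 < r
  differentiableAt : ∀ w ∈ Metric.ball z r, DifferentiableAt ℝ ρ w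
  holder : HolderOnWith K γ (fderiv ℝ ρ) (Metric.ball z r)
  fderiv_ne_zero : fderiv ℝ ρ z ≠ 0
  map_center : ρ z = 0
  mem_iff : ∀ w ∈ Metric.ball z r, w ∈ U ↔ ρ w < 0

namespace IsLocalDefiningFunction

variable {γ K : ℝ≥0} {U : Set ℂ} {z : ℂ} {r : ℝ} {ρ : ℂ → ℝ}

theorem neg_of_mem_iff {V : Set ℂ} (h : IsLocalDefiningFunction γ U z r ρ K)
    (hV : ∀ w ∈ Metric.ball z r, w ∈ V ↔ 0 < ρ w) :
    IsLocalDefiningFunction γ V z r (fun w => -ρ w) K where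
  pos := h.pos
  differentiableAt w hw := (h.differentiableAt w hw).neg
  holder x hx y hy := by
    have := h.holder x hx y hy
    rw [show fderiv ℝ (fun w => -ρ w) x = -fderiv ℝ ρ x from fderiv_fun_neg,
      show fderiv ℝ (fun w => -ρ w) y = -fderiv ℝ ρ y from fderiv_fun_neg, edist_neg_neg]
    exact this
  fderiv_ne_zero := by
    rw [show fderiv ℝ (fun w => -ρ w) z = -fderiv ℝ ρ z from fderiv_fun_neg]
    exact neg_ne_zero.mpr h.fderiv_ne_zero
  map_center := by simp [h.map_center]
  mem_iff w hw := by simp [hV w hw]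

theorem continuousOn (h : IsLocalDefiningFunction γ U z r ρ K) :
    ContinuousOn ρ (Metric.ball z r) :=
  fun w hw => (h.differentiableAt w hw).continuousAt.continuousWithinAt

theorem norm_fderiv_sub_le (h : IsLocalDefiningFunction γ U z r ρ K) {x y : ℂ}
    (hx : x ∈ Metric.ball z r) (hy : y ∈ Metric.ball z r) :
    ‖fderiv ℝ ρ x - fderiv ℝ ρ y‖ ≤ K * ‖x - y‖ ^ (γ : ℝ) := by
  have := h.holder.dist_le hx hy
  rwa [dist_eq_norm, dist_eq_norm] at this

theorem continuousAt_fderiv (h : IsLocalDefiningFunction γ U z r ρ K) (hγ : 0 < γ) :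
    ContinuousAt (fderiv ℝ ρ) z :=
  ((h.holder.uniformContinuousOn hγ).continuousOn).continuousAt (Metric.ball_mem_nhds z h.pos)

theorem continuousAt_unitNormal (h : IsLocalDefiningFunction γ U z r ρ K) (hγ : 0 < γ) :
    ContinuousAt (unitNormal ρ) z := by
  have h1 : ContinuousAt (fun x => complexGradient (fderiv ℝ ρ x)) z :=
    ContinuousAt.comp (f := fderiv ℝ ρ) continuous_complexGradient.continuousAt
      (h.continuousAt_fderiv hγ)
  refine h1.div (Complex.continuous_ofReal.continuousAt.comp h1.norm) ?_
  simpa using complexGradient_ne_zero h.fderiv_ne_zero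

/-- First-order Taylor expansion with Hölder remainder. -/
theorem abs_sub_sub_fderiv_le (h : IsLocalDefiningFunction γ U z r ρ K) {x y : ℂ}
    (hx : x ∈ Metric.ball z r) (hy : y ∈ Metric.ball z r) :
    |ρ y - ρ x - fderiv ℝ ρ x (y - x)| ≤ K * ‖y - x‖ ^ (1 + (γ : ℝ)) := by
  rcases eq_or_ne y x with rfl | hne
  · simp; positivity
  have hpos : 0 < ‖y - x‖ := norm_pos_iff.mpr (sub_ne_zero.mpr hne)
  have := (convex_segment x y).norm_image_sub_le_of_norm_hasFDerivWithin_le' (𝕜 := ℝ)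
    (f := ρ) (f' := fderiv ℝ ρ) (φ := fderiv ℝ ρ x) (C := K * ‖y - x‖ ^ (γ : ℝ))
    (fun w hw => (h.differentiableAt w ((convex_ball z r).segment_subset hx hy hw)).hasFDerivAt.hasFDerivWithinAt)
    (fun w hw => (h.norm_fderiv_sub_le ((convex_ball z r).segment_subset hx hy hw) hx).trans (by
      gcongr
      obtain ⟨t, ht, rfl⟩ := (segment_eq_image' ℝ x y) ▸ hw
      simp only [add_sub_cancel_left, norm_smul, Real.norm_of_nonneg ht.1]
      exact mul_le_of_le_one_left hpos.le ht.2)) (left_mem_segment ℝ x y) (right_mem_segment ℝ x y)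
  rw [Real.norm_eq_abs, mul_assoc, mul_comm (_ ^ _)] at this
  rw [Real.rpow_add hpos, Real.rpow_one]
  exact this

/-- Near `z`, the sign of `ρ` about its zeros is that of the linear part, off a cusp. -/
theorem exists_cusp (h : IsLocalDefiningFunction γ U z r ρ K) (hγ : 0 < γ) :
    ∃ δ C : ℝ, 0 < δ ∧ 2 * δ ≤ r ∧ 0 ≤ C ∧
      (∀ x ∈ Metric.ball z δ, complexGradient (fderiv ℝ ρ x) ≠ 0) ∧
      ∀ x ∈ Metric.ball z δ, ρ x = 0 → ∀ y : ℂ, ‖y‖ < δ → C * ‖y‖ ^ (1 + (γ : ℝ)) < |y.re| →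
        (x + unitNormal ρ x * y ∈ U ↔ y.re < 0) := by
  set m := ‖complexGradient (fderiv ℝ ρ z)‖ / 2 with hm
  have hN := norm_pos_iff.mpr (complexGradient_ne_zero h.fderiv_ne_zero)
  have hm0 : 0 < m := by positivity
  have h1 : ContinuousAt (fun x => ‖complexGradient (fderiv ℝ ρ x)‖) z :=
    (ContinuousAt.comp (f := fderiv ℝ ρ) continuous_complexGradient.continuousAt
      (h.continuousAt_fderiv hγ)).norm
  obtain ⟨δ₀, hδ₀, hδ⟩ := Metric.eventually_nhds_iff_ball.mp
    (h1.eventually_const_lt (show m < _ by linarith))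
  -- The gradient has norm above m on the disc, so with C = K/m the linear term dominates the Taylor
  -- remainder as soon as |Re y| > C|y|^{1+γ}.
  refine ⟨min δ₀ (r / 2), K / m, lt_min hδ₀ (by linarith [h.pos]), ?_, by positivity, ?_, ?_⟩
  · linarith [min_le_right δ₀ (r / 2)]
  · intro x hx
    exact norm_pos_iff.mp (hm0.trans (hδ x (Metric.ball_subset_ball (min_le_left _ _) hx)))
  · intro x hx hρ y hy hC
    have hNx := hδ x (Metric.ball_subset_ball (min_le_left _ _) hx)
    have hn := norm_unitNormal (norm_pos_iff.mp (hm0.trans hNx))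
    have hx2 : dist x z < r / 2 := (Metric.mem_ball.mp hx).trans_le (min_le_right _ _)
    have hxr : x ∈ Metric.ball z r := Metric.mem_ball.mpr (by linarith [h.pos])
    have hyr : x + unitNormal ρ x * y ∈ Metric.ball z r := by
      rw [Metric.mem_ball, dist_eq_norm]
      rw [dist_eq_norm] at hx2
      calc _ = ‖(x - z) + unitNormal ρ x * y‖ := by ring_nf
        _ ≤ ‖x - z‖ + ‖y‖ := (norm_add_le _ _).trans (by rw [norm_mul, hn, one_mul])
        _ < r := by linarith [min_le_right δ₀ (r / 2)]
    rw [h.mem_iff _ hyr]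
    have hT := h.abs_sub_sub_fderiv_le hxr hyr
    rw [add_sub_cancel_left, fderiv_apply_unitNormal_mul, norm_mul, hn, one_mul, hρ, sub_zero] at hT
    have hlt : K * ‖y‖ ^ (1 + (γ : ℝ)) < m * |y.re| := by
      rw [div_mul_eq_mul_div, div_lt_iff₀ hm0] at hC
      linarith
    have hlt2 : K * ‖y‖ ^ (1 + (γ : ℝ)) < ‖complexGradient (fderiv ℝ ρ x)‖ * |y.re| :=
      hlt.trans_le (by gcongr)
    have hTb := abs_le.mp hT
    constructor
    · intro hneg
      by_contra hre
      rw [abs_of_nonneg (not_lt.mp hre)] at hlt2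
      linarith [hTb.1]
    · intro hre
      rw [abs_of_neg hre] at hlt2
      linarith [hTb.2]

/-- A point of `U` near `z` lies on the inner normal through a nearest point of the complement. -/
theorem exists_foot (h : IsLocalDefiningFunction γ U z r ρ K) (hU : IsOpen U) {δ : ℝ}
    (hδr : 2 * δ ≤ r) (hN : ∀ x ∈ Metric.ball z δ, complexGradient (fderiv ℝ ρ x) ≠ 0) {w : ℂ}
    (hw : w ∈ U) (hwz : 2 * ‖w - z‖ < δ) :
    ∃ (x : ℂ) (d : ℝ), 0 < d ∧ d ≤ ‖w - z‖ ∧ ‖x - z‖ ≤ 2 * ‖w - z‖ ∧ ρ x = 0 ∧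
      w = x - d * unitNormal ρ x ∧ Metric.ball w d ⊆ U := by
  have hzU : z ∈ Uᶜ := fun hz => by
    have := (h.mem_iff z (Metric.mem_ball_self h.pos)).mp hz
    rw [h.map_center] at this
    exact lt_irrefl _ this
  obtain ⟨x, hxU, hx⟩ := hU.isClosed_compl.exists_infDist_eq_dist ⟨z, hzU⟩ w
  have hne : w ≠ x := fun e => hxU (e ▸ hw)
  have hd : 0 < ‖w - x‖ := norm_pos_iff.mpr (sub_ne_zero.mpr hne)
  have hdz : ‖w - x‖ ≤ ‖w - z‖ := by
    rw [← dist_eq_norm, ← dist_eq_norm, ← hx]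
    exact Metric.infDist_le_dist_of_mem hzU
  have hball : Metric.ball w ‖w - x‖ ⊆ U := by
    intro y hy
    by_contra hyU
    have := Metric.infDist_le_dist_of_mem (x := w) (show y ∈ Uᶜ from hyU)
    rw [hx, dist_comm w y] at this
    rw [Metric.mem_ball, ← dist_eq_norm] at hy
    linarith
  have hxz : ‖x - z‖ ≤ 2 * ‖w - z‖ := by
    calc ‖x - z‖ = ‖(w - z) - (w - x)‖ := by ring_nf
      _ ≤ _ := (norm_sub_le _ _).trans (by linarith)
  have hxδ : x ∈ Metric.ball z δ := by
    rw [Metric.mem_ball, dist_eq_norm]; linarith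
  have hxr : x ∈ Metric.ball z r := by
    rw [Metric.mem_ball, dist_eq_norm]; linarith [norm_nonneg (w - z)]
  set N := complexGradient (fderiv ℝ ρ x) with hNdef
  -- directions pointing into the disc about `w` decrease `ρ`
  have hdir : ∀ v : ℂ, 0 < (conj (w - x) * v).re → ∀ᶠ t in 𝓝[>] (0 : ℝ), ρ (x + t • v) < 0 := by
    intro v hv
    have hv0 : v ≠ 0 := by rintro rfl; simp at hv
    have hv' : 0 < ‖v‖ ^ 2 := by positivity
    have hc : Tendsto (fun t : ℝ => x + t • v) (𝓝[>] 0) (𝓝 x) := by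
      have : Continuous fun t : ℝ => x + t • v := by fun_prop
      have := (this.tendsto 0).mono_left (nhdsWithin_le_nhds (s := Ioi 0))
      simpa using this
    filter_upwards [hc.eventually (Metric.isOpen_ball.mem_nhds hxr), self_mem_nhdsWithin,
      nhdsWithin_le_nhds (Iio_mem_nhds (show 0 < 2 * (conj (w - x) * v).re / ‖v‖ ^ 2 by positivity))]
      with t h1 h2 h3
    refine (h.mem_iff _ h1).mp (hball ?_)
    rw [Metric.mem_ball, dist_eq_norm]
    have h2' : 0 < t := h2
    refine lt_of_pow_lt_pow_left₀ 2 hd.le ?_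
    rw [mem_Iio, lt_div_iff₀ hv'] at h3
    have e : ‖x + t • v - w‖ ^ 2 = ‖w - x‖ ^ 2 - 2 * t * (conj (w - x) * v).re + t ^ 2 * ‖v‖ ^ 2 := by
      simp only [← Complex.normSq_eq_norm_sq, Complex.normSq_apply]
      simp
      ring
    rw [e]
    nlinarith
  -- The foot is a limit of points of U inside the disc about `w`, which gives ρ ≤ 0; it is not in
  -- U, which gives ρ ≥ 0.
  have hρ0 : ρ x = 0 := by
    apply le_antisymm
    · have h1 := hdir (w - x) (by
        rw [mul_comm, Complex.mul_conj, Complex.ofReal_re, Complex.normSq_eq_norm_sq]; positivity)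
      have hc : Tendsto (fun t : ℝ => x + t • (w - x)) (𝓝[>] 0) (𝓝 x) := by
        have : Continuous fun t : ℝ => x + t • (w - x) := by fun_prop
        have := (this.tendsto 0).mono_left (nhdsWithin_le_nhds (s := Ioi 0))
        simpa using this
      exact le_of_tendsto ((h.differentiableAt x hxr).continuousAt.tendsto.comp hc)
        (h1.mono fun t ht => ht.le)
    · exact not_lt.mp fun hlt => hxU ((h.mem_iff x hxr).mpr hlt)
  have hdir2 : ∀ v : ℂ, 0 < (conj (w - x) * v).re → (conj N * v).re ≤ 0 := by
    intro v hv
    rw [← apply_eq_re_conj_complexGradient]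
    have hder := ((h.differentiableAt x hxr).hasFDerivAt.hasLineDerivAt v).tendsto_slope_zero_right
    refine le_of_tendsto hder ?_
    filter_upwards [hdir v hv, self_mem_nhdsWithin] with t ht ht0
    have ht0' : 0 < t := ht0
    rw [hρ0, sub_zero, smul_eq_mul]
    exact mul_nonpos_of_nonneg_of_nonpos (inv_nonneg.mpr ht0'.le) ht.le
  set q := conj N * (w - x) with hq
  -- The directions (w - x)(1 + is) enter the disc for every real s. The resulting inequality,
  -- affine in s, forces `q` to be real and nonpositive: the gradient at x points away from w.
  have hs : ∀ s : ℝ, q.re - s * q.im ≤ 0 := by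
    intro s
    have := hdir2 ((w - x) * (1 + s * Complex.I)) (by
      rw [← mul_assoc, mul_comm (conj (w - x)), Complex.mul_conj, Complex.normSq_eq_norm_sq,
        Complex.re_ofReal_mul]
      simpa using pow_pos hd 2)
    rw [← mul_assoc, ← hq] at this
    simpa [mul_comm] using this
  have him : q.im = 0 := by
    by_contra hne
    have := hs ((q.re - 1) / q.im)
    rw [div_mul_cancel₀ _ hne] at this
    linarith
  have hre : q.re ≤ 0 := by simpa using hs 0
  have hN0 := hN x hxδ
  have hqn : ‖q‖ = ‖N‖ * ‖w - x‖ := by rw [hq, norm_mul, Complex.norm_conj]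
  have hq2 : q = -(‖N‖ * ‖w - x‖ : ℝ) := by
    rw [← hqn]
    apply Complex.ext
    · have : ‖q‖ = |q.re| := (Complex.abs_re_eq_norm.mpr him).symm
      simp [this, abs_of_nonpos hre]
    · simp [him]
  refine ⟨x, ‖w - x‖, hd, hdz, hxz, hρ0, ?_, hball⟩
  have hcN : conj N ≠ 0 := by simpa using hN0
  have hfin : conj N * (w - x) = conj N * (-(‖w - x‖ * unitNormal ρ x)) := by
    have := conj_complexGradient_mul_unitNormal ρ x
    rw [← hNdef] at this
    rw [← hq, hq2, mul_neg, mul_left_comm, this]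
    push_cast
    ring
  have := mul_left_cancel₀ hcN hfin
  linear_combination this

/-- The zero set of a defining function is locally null. -/
theorem exists_volume_zero (h : IsLocalDefiningFunction γ U z r ρ K) (hγ : 0 < γ) :
    ∃ δ : ℝ, 0 < δ ∧ δ ≤ r ∧ volume {x ∈ Metric.ball z δ | ρ x = 0} = 0 := by
  set m := ‖complexGradient (fderiv ℝ ρ z)‖ with hm
  have hN := complexGradient_ne_zero h.fderiv_ne_zero
  have hm0 : 0 < m := norm_pos_iff.mpr hN
  have h1 : ContinuousAt (fun x => ‖fderiv ℝ ρ x - fderiv ℝ ρ z‖) z :=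
    ((h.continuousAt_fderiv hγ).sub continuousAt_const).norm
  obtain ⟨δ₀, hδ₀, hδ⟩ := Metric.eventually_nhds_iff_ball.mp
    (h1.eventually_lt_const (show _ < m / 2 by simpa using hm0))
  have hsub1 := Metric.ball_subset_ball (x := z) (min_le_left δ₀ r)
  have hsub2 := Metric.ball_subset_ball (x := z) (min_le_right δ₀ r)
  refine ⟨min δ₀ r, lt_min hδ₀ h.pos, min_le_right _ _, ?_⟩
  set E := {x ∈ Metric.ball z (min δ₀ r) | ρ x = 0} with hE
  have hEm : MeasurableSet E := by
    have ho := (h.continuousOn.mono hsub2).isOpen_inter_preimage Metric.isOpen_ball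
      (isOpen_compl_singleton (x := (0 : ℝ)))
    have : E = Metric.ball z (min δ₀ r) \ (Metric.ball z (min δ₀ r) ∩ ρ ⁻¹' {0}ᶜ) := by
      ext x; simp [hE]
    rw [this]
    exact measurableSet_ball.diff ho.measurableSet
  set n := unitNormal ρ z with hn
  have hn1 : ‖n‖ = 1 := norm_unitNormal hN
  -- The derivative of ρ along the fixed direction n stays within m/2 of m, so ρ vanishes at most
  -- once on each segment parallel to n in the ball.
  have huniq : ∀ x ∈ E, ∀ t : ℝ, x + n * t ∈ E → t = 0 := by
    intro x hx t hxt
    by_contra ht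
    have := (convex_ball z (min δ₀ r)).norm_image_sub_le_of_norm_hasFDerivWithin_le' (𝕜 := ℝ)
      (f := ρ) (f' := fderiv ℝ ρ) (φ := fderiv ℝ ρ z) (C := m / 2)
      (fun w hw => (h.differentiableAt w (hsub2 hw)).hasFDerivAt.hasFDerivWithinAt)
      (fun w hw => (hδ w (hsub1 hw)).le) hx.1 hxt.1
    rw [hx.2, hxt.2, add_sub_cancel_left, fderiv_apply_unitNormal_mul, norm_mul, hn1, ← hm] at this
    simp only [sub_zero, zero_sub, norm_neg, norm_mul, Complex.ofReal_re, Complex.norm_real,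
      one_mul, Real.norm_of_nonneg hm0.le] at this
    have ht' : 0 < ‖t‖ := norm_pos_iff.mpr ht
    nlinarith
  have hpre : volume ((fun u : ℂ => n * u) ⁻¹' E) = volume E :=
    (measurePreserving_mul_of_norm_eq_one hn1).measure_preimage hEm.nullMeasurableSet
  have hEm' : MeasurableSet ((fun u : ℂ => n * u) ⁻¹' E) := (measurable_const_mul n) hEm
  rw [← hpre]
  -- After rotating n to the real axis, the swap makes the Fubini slices horizontal; each has at
  -- most one point.
  have hsw : MeasurePreserving (fun p : ℝ × ℝ => Complex.measurableEquivRealProd.symm p.swap) :=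
    (Complex.volume_preserving_equiv_real_prod.symm _).comp
      (Measure.measurePreserving_swap (μ := (volume : Measure ℝ)) (ν := (volume : Measure ℝ)))
  rw [← hsw.measure_preimage hEm'.nullMeasurableSet, Measure.volume_eq_prod,
    Measure.measure_prod_null (hsw.measurable hEm')]
  refine Eventually.of_forall fun b => ?_
  refine Set.Subsingleton.measure_zero (fun s hs t ht => ?_) _
  have hs' : n * ⟨s, b⟩ ∈ E := hs
  have ht' : n * ⟨t, b⟩ ∈ E := ht
  have := huniq _ hs' (t - s) (by
    convert ht' using 1
    rw [← mul_add]
    congr 1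
    apply Complex.ext <;> simp)
  linarith

end IsLocalDefiningFunction

/-! ### The principal value over a domain, compared with the tangent half plane. -/

/-- The integral of the kernel over the part of `U` in the annulus `ε ≤ |ζ - w| < R`. -/
noncomputable def annulusTransform (U : Set ℂ) (R ε : ℝ) (w : ℂ) : ℂ :=
  ∫ u in annulus ε R, U.indicator 1 (w + u) * conjKernel u

/-- The kernel with pole at `-d`, on the disc of radius `R` about the pole, weighted with the
difference between the set `U` seen from `x` in the frame `n` and the left half plane. -/
noncomputable def cuspIntegrand (U : Set ℂ) (R : ℝ) (x n : ℂ) (d : ℝ) (y : ℂ) : ℂ :=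
  {y : ℂ | ‖y + d‖ < R}.indicator
    (fun y => (U.indicator 1 (x + n * y) - {v : ℂ | v.re < 0}.indicator 1 y) *
      conjKernel (y + d)) y

theorem measurable_cuspIntegrand {U : Set ℂ} (hU : MeasurableSet U) (R : ℝ) (x n : ℂ) (d : ℝ) :
    Measurable (cuspIntegrand U R x n d) := by
  refine Measurable.indicator (Measurable.mul (Measurable.sub ?_ ?_) ?_) ?_
  · exact (measurable_one.indicator hU).comp (by fun_prop : Measurable fun y : ℂ => x + n * y)
  · exact measurable_one.indicator (measurableSet_re_lt 0)
  · exact measurable_conjKernel.comp (by fun_prop : Measurable fun y : ℂ => y + d)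
  · exact measurableSet_lt (by fun_prop) measurable_const

theorem norm_indicator_sub_indicator_le (s t : Set ℂ) (a b : ℂ) :
    ‖(s.indicator 1 a - t.indicator 1 b : ℂ)‖ ≤ 1 := by
  by_cases h1 : a ∈ s <;> by_cases h2 : b ∈ t <;> simp [h1, h2]

theorem measurable_indicator_comp_affine {U : Set ℂ} (hU : MeasurableSet U) (w n : ℂ) :
    Measurable fun v : ℂ => (U.indicator 1 (w + n * v) : ℂ) :=
  (measurable_one.indicator hU).comp (by fun_prop : Measurable fun v : ℂ => w + n * v)

/-- The annulus integral in a rotated frame, compared with a half plane. -/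
theorem annulusTransform_eq_rotate {U : Set ℂ} (hU : MeasurableSet U) {R ε : ℝ} (hε : 0 < ε)
    {w n : ℂ} (hn : ‖n‖ = 1) (d : ℝ) :
    annulusTransform U R ε w = n ^ 2 *
      ((∫ v in annulus ε R, (U.indicator 1 (w + n * v) - {v : ℂ | v.re < d}.indicator 1 v) *
        conjKernel v) + ∫ v in annulus ε R, {v : ℂ | v.re < d}.indicator 1 v * conjKernel v) := by
  have h1 : IntegrableOn (fun v => (U.indicator 1 (w + n * v) - {v : ℂ | v.re < d}.indicator 1 v) *
      conjKernel v) (annulus ε R) :=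
    integrableOn_annulus_mul_conjKernel (M := 1) hε
      ((measurable_indicator_comp_affine hU w n).sub
        (measurable_one.indicator (measurableSet_re_lt d))).aestronglyMeasurable
      fun u _ => norm_indicator_sub_indicator_le _ _ _ _
  rw [← integral_add h1 (integrableOn_annulus_indicator hε R (measurableSet_re_lt d)),
    ← integral_const_mul, annulusTransform, ← setIntegral_annulus_comp_mul hn]
  congr 1 with v
  rw [conjKernel_mul, conjKernel_of_norm_eq_one hn]
  ring

namespace IsLocalDefiningFunction

variable {γ K : ℝ≥0} {U : Set ℂ} {z : ℂ} {r : ℝ} {ρ : ℂ → ℝ}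

/-- Off the cusp the two indicators agree. On it |Re y| ≤ |y|/2, so |y + d|² ≥ |y|² - d|y| + d² ≥
|y|²/2, and moving the pole to -d costs only a factor 2. The bound is uniform in x and d, as
dominated convergence requires. -/
theorem norm_cuspIntegrand_le {U : Set ℂ} {C γ R : ℝ} (hC : 0 ≤ C) (hγ : 0 < γ)
    (hCR : C * (2 * R) ^ γ ≤ 1 / 2) {x n : ℂ} (hx : x ∉ U)
    (hcusp : ∀ y : ℂ, ‖y‖ < 2 * R → C * ‖y‖ ^ (1 + γ) < |y.re| → (x + n * y ∈ U ↔ y.re < 0))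
    {d : ℝ} (hd : 0 ≤ d) (hdR : d ≤ R) (y : ℂ) :
    ‖cuspIntegrand U R x n d y‖ ≤ 2 * (cusp C γ (2 * R)).indicator (fun u => (‖u‖ ^ 2)⁻¹) y := by
  have hnn : 0 ≤ 2 * (cusp C γ (2 * R)).indicator (fun u => (‖u‖ ^ 2)⁻¹) y :=
    mul_nonneg zero_le_two (indicator_nonneg (fun _ _ => by positivity) _)
  by_cases hy : ‖y + d‖ < R
  swap
  · rw [cuspIntegrand, indicator_of_notMem (show y ∉ {y : ℂ | ‖y + d‖ < R} from hy), norm_zero]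
    exact hnn
  rw [cuspIntegrand, indicator_of_mem (show y ∈ {y : ℂ | ‖y + d‖ < R} from hy)]
  have hy2 : ‖y‖ < 2 * R := by
    calc ‖y‖ = ‖(y + d) - d‖ := by ring_nf
      _ ≤ ‖y + d‖ + ‖(d : ℂ)‖ := norm_sub_le _ _
      _ < 2 * R := by rw [Complex.norm_real, Real.norm_of_nonneg hd]; linarith
  by_cases hyc : y ∈ cusp C γ (2 * R)
  · rw [indicator_of_mem hyc]
    -- At y = 0 the majorant is 0 by the convention 0⁻¹ = 0, and the integrand vanishes because x is
    -- outside U and 0 is outside the open half plane.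
    rcases eq_or_ne y 0 with rfl | hy0
    · simp [hx]
    have hypos : 0 < ‖y‖ := norm_pos_iff.mpr hy0
    have hre : |y.re| ≤ ‖y‖ / 2 := by
      refine hyc.1.trans ?_
      rw [Real.rpow_add hypos, Real.rpow_one]
      have : C * ‖y‖ ^ γ ≤ 1 / 2 := le_trans (by gcongr) hCR
      nlinarith
    have hsq : ‖y + d‖ ^ 2 = ‖y‖ ^ 2 + 2 * d * y.re + d ^ 2 := by
      simp only [← Complex.normSq_eq_norm_sq, Complex.normSq_apply]
      simp
      ring
    have hlow : ‖y‖ ^ 2 / 2 ≤ ‖y + d‖ ^ 2 := by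
      have h1 := (abs_le.mp hre).1
      rw [hsq]
      nlinarith [sq_nonneg (2 * d - ‖y‖), mul_le_mul_of_nonneg_left h1 hd]
    rw [norm_mul, norm_conjKernel]
    calc _ ≤ 1 * (‖y + d‖ ^ 2)⁻¹ := by
          gcongr; exact norm_indicator_sub_indicator_le _ _ _ _
      _ ≤ 1 * (‖y‖ ^ 2 / 2)⁻¹ := by gcongr
      _ = 2 * (‖y‖ ^ 2)⁻¹ := by rw [inv_div]; ring
  · have hlt : C * ‖y‖ ^ (1 + γ) < |y.re| := by
      by_contra hle
      exact hyc ⟨not_lt.mp hle, hy2⟩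
    have hiff := hcusp y hy2 hlt
    refine le_trans (le_of_eq ?_) hnn
    by_cases hre : y.re < 0
    · simp [hre, hiff.mpr hre]
    · simp [hre, show x + n * y ∉ U from fun h => hre (hiff.mp h)]

/-- At a point off the complement, the annulus integrals are eventually constant. -/
theorem annulusTransform_of_foot {U : Set ℂ} (hU : MeasurableSet U) {R ε d : ℝ} (hε : 0 < ε)
    (hεd : ε ≤ d) (hdR : d ≤ R) {w x n : ℂ} (hn : ‖n‖ = 1) (hw : w = x - d * n)
    (hball : Metric.ball w d ⊆ U) :
    annulusTransform U R ε w = n ^ 2 * ((∫ y, cuspIntegrand U R x n d y) +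
      ∫ u in annulus d R, (strip d).indicator 1 u * conjKernel u) := by
  rw [annulusTransform_eq_rotate hU hε hn d, setIntegral_annulus_re_lt hε hεd hdR]
  congr 2
  rw [← integral_indicator (measurableSet_annulus ε R),
    ← integral_add_right_eq_self _ (d : ℂ)]
  congr 1 with y
  have e1 : w + n * (y + d) = x + n * y := by rw [hw]; ring
  have e2 : (y + d : ℂ).re < d ↔ y.re < 0 := by simp
  by_cases hR : ‖y + d‖ < R
  · rw [cuspIntegrand, indicator_of_mem (show y ∈ {y : ℂ | ‖y + d‖ < R} from hR)]
    by_cases hεy : ε ≤ ‖y + d‖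
    · rw [indicator_of_mem (show y + (d : ℂ) ∈ annulus ε R from ⟨hεy, hR⟩), e1]
      congr 2
      by_cases hy : y.re < 0
      · rw [indicator_of_mem (show y + (d : ℂ) ∈ {v : ℂ | v.re < d} from e2.mpr hy),
          indicator_of_mem (show y ∈ {v : ℂ | v.re < 0} from hy)]; rfl
      · rw [indicator_of_notMem (show y + (d : ℂ) ∉ {v : ℂ | v.re < d} from fun h => hy (e2.mp h)),
          indicator_of_notMem (show y ∉ {v : ℂ | v.re < 0} from hy)]
    -- The excised disc lies both in U and in the half plane, so the difference of indicators
    -- vanishes there and ε drops out.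
    · rw [indicator_of_notMem (fun h : y + (d : ℂ) ∈ annulus ε R => hεy h.1)]
      have hlt : ‖y + d‖ < d := (not_le.mp hεy).trans_le hεd
      have h1 : y.re < 0 := e2.mp ((Complex.re_le_norm _).trans_lt hlt)
      have h2 : x + n * y ∈ U := by
        apply hball
        rw [← e1, Metric.mem_ball, dist_eq_norm, add_sub_cancel_left, norm_mul, hn, one_mul]
        exact hlt
      simp [h1, h2]
  · rw [cuspIntegrand, indicator_of_notMem (show y ∉ {y : ℂ | ‖y + d‖ < R} from hR),
      indicator_of_notMem (fun h : y + (d : ℂ) ∈ annulus ε R => hR h.2)]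

/-- The annulus integrals converge at a boundary point with a cusp estimate. -/
theorem tendsto_annulusTransform_center {U : Set ℂ} (hU : MeasurableSet U) {C γ R : ℝ}
    (hC : 0 ≤ C) (hγ : 0 < γ) (hγ₁ : γ ≤ 1) (hR : 0 < R) (hCR : C * (2 * R) ^ γ ≤ 1 / 2)
    {x n : ℂ} (hn : ‖n‖ = 1) (hx : x ∉ U)
    (hcusp : ∀ y : ℂ, ‖y‖ < 2 * R → C * ‖y‖ ^ (1 + γ) < |y.re| → (x + n * y ∈ U ↔ y.re < 0)) :
    Tendsto (fun ε => annulusTransform U R ε x) (𝓝[>] 0)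
      (𝓝 (n ^ 2 * ∫ y, cuspIntegrand U R x n 0 y)) := by
  have hlim : Tendsto (fun ε : ℝ => ∫ y, {y : ℂ | ε ≤ ‖y‖}.indicator (cuspIntegrand U R x n 0) y)
      (𝓝[>] 0) (𝓝 (∫ y, cuspIntegrand U R x n 0 y)) := by
    refine tendsto_integral_filter_of_dominated_convergence _ ?_ ?_
      ((integrable_indicator_cusp hγ hγ₁ hC (2 * R)).const_mul 2) ?_
    · exact Eventually.of_forall fun ε => ((measurable_cuspIntegrand hU R x n 0).indicator
        (measurableSet_le measurable_const measurable_norm)).aestronglyMeasurable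
    · exact Eventually.of_forall fun ε => Eventually.of_forall fun y =>
        (norm_indicator_le_norm_self _ _).trans
          (norm_cuspIntegrand_le hC hγ hCR hx hcusp le_rfl hR.le y)
    · have h0 : ∀ᵐ y : ℂ, y ≠ 0 := by rw [ae_iff]; simp
      filter_upwards [h0] with y hy
      refine tendsto_const_nhds.congr' ?_
      filter_upwards [nhdsWithin_le_nhds (Iio_mem_nhds (norm_pos_iff.mpr hy))] with ε hε
      rw [indicator_of_mem (show y ∈ {y : ℂ | ε ≤ ‖y‖} from (mem_Iio.mp hε).le)]
  refine (hlim.const_mul (n ^ 2)).congr' ?_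
  filter_upwards [self_mem_nhdsWithin] with ε hε
  rw [annulusTransform_eq_rotate hU hε hn 0, setIntegral_annulus_halfPlane_conjKernel hε, add_zero,
    ← integral_indicator (measurableSet_annulus ε R)]
  congr 2 with y
  by_cases h1 : ε ≤ ‖y‖ <;> by_cases h2 : ‖y‖ < R <;>
    simp [indicator, cuspIntegrand, annulus, h1, h2]

/-- Dominated convergence. For almost every y the point z + n·y avoids the zero set of ρ, so
membership in U is stable under small changes of the foot and the normal. -/
theorem tendsto_integral_cuspIntegrand (h : IsLocalDefiningFunction γ U z r ρ K) (hU : IsOpen U)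
    (hγ : 0 < γ) (hγ₁ : γ ≤ 1) {C R δ : ℝ} (hδ : 0 < δ) (hC : 0 ≤ C) (hR : 0 < R)
    (hRr : 2 * R ≤ r) (hnull : volume {x ∈ Metric.ball z (2 * R) | ρ x = 0} = 0)
    (hCR : C * (2 * R) ^ (γ : ℝ) ≤ 1 / 2)
    (hN : complexGradient (fderiv ℝ ρ z) ≠ 0)
    (hcusp : ∀ x ∈ Metric.ball z δ, ρ x = 0 → ∀ y : ℂ, ‖y‖ < 2 * R →
      C * ‖y‖ ^ (1 + (γ : ℝ)) < |y.re| → (x + unitNormal ρ x * y ∈ U ↔ y.re < 0))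
    {ι : Type*} {l : Filter ι} [l.IsCountablyGenerated] {x : ι → ℂ} {d : ι → ℝ}
    (hx : Tendsto x l (𝓝 z)) (hd : Tendsto d l (𝓝 0)) (hx0 : ∀ᶠ i in l, ρ (x i) = 0)
    (hd0 : ∀ᶠ i in l, 0 ≤ d i) :
    Tendsto (fun i => ∫ y, cuspIntegrand U R (x i) (unitNormal ρ (x i)) (d i) y) l
      (𝓝 (∫ y, cuspIntegrand U R z (unitNormal ρ z) 0 y)) := by
  have hn1 := norm_unitNormal hN
  refine tendsto_integral_filter_of_dominated_convergence _ ?_ ?_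
      ((integrable_indicator_cusp (by exact_mod_cast hγ) (by exact_mod_cast hγ₁) hC
        (2 * R)).const_mul 2) ?_
  · exact Eventually.of_forall fun i =>
      (measurable_cuspIntegrand hU.measurableSet R _ _ _).aestronglyMeasurable
  · filter_upwards [hx0, hd0, hd.eventually (Iic_mem_nhds hR),
      hx.eventually (Metric.ball_mem_nhds z hδ), hx.eventually (Metric.ball_mem_nhds z h.pos)]
      with i h1 h2 h3 h4 h5
    refine Eventually.of_forall fun y => norm_cuspIntegrand_le hC (by exact_mod_cast hγ) hCR ?_
      (hcusp _ h4 h1) h2 h3 y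
    rw [h.mem_iff _ h5, h1]
    exact lt_irrefl _
  · have h0 : ∀ᵐ y : ℂ, y ≠ 0 := by rw [ae_iff]; simp
    have h1 : ∀ᵐ y : ℂ, ‖y‖ ≠ R := by
      rw [ae_iff]
      convert Measure.addHaar_sphere (volume : Measure ℂ) 0 R using 2
      ext y; simp
    have h2 : ∀ᵐ y : ℂ, z + unitNormal ρ z * y ∉ {x ∈ Metric.ball z (2 * R) | ρ x = 0} := by
      have hmp : MeasurePreserving (fun y : ℂ => z + unitNormal ρ z * y) :=
        (measurePreserving_add_left volume z).comp (measurePreserving_mul_of_norm_eq_one hn1)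
      exact hmp.quasiMeasurePreserving.ae (measure_eq_zero_iff_ae_notMem.mp hnull)
    filter_upwards [h0, h1, h2] with y hy0 hyR hyρ
    have hyd : Tendsto (fun i => y + (d i : ℂ)) l (𝓝 y) := by
      simpa using tendsto_const_nhds.add ((Complex.continuous_ofReal.tendsto 0).comp hd)
    rcases lt_or_gt_of_ne hyR with hlt | hgt
    · have hζ : Tendsto (fun i => x i + unitNormal ρ (x i) * y) l (𝓝 (z + unitNormal ρ z * y)) :=
        hx.add (((h.continuousAt_unitNormal hγ).tendsto.comp hx).mul_const y)
      have hmem : z + unitNormal ρ z * y ∈ Metric.ball z (2 * R) := by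
        rw [Metric.mem_ball, dist_eq_norm, add_sub_cancel_left, norm_mul, hn1, one_mul]
        linarith
      have hmemr := Metric.ball_subset_ball hRr hmem
      have hρne : ρ (z + unitNormal ρ z * y) ≠ 0 := fun h => hyρ ⟨hmem, h⟩
      have hind : ∀ᶠ i in l, (U.indicator 1 (x i + unitNormal ρ (x i) * y) : ℂ) =
          U.indicator 1 (z + unitNormal ρ z * y) := by
        rcases lt_or_gt_of_ne hρne with hneg | hpos
        · have hzU := (h.mem_iff _ hmemr).mpr hneg
          filter_upwards [hζ.eventually (hU.mem_nhds hzU)] with i hi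
          rw [indicator_of_mem (show _ ∈ U from hi), indicator_of_mem hzU]
          rfl
        · have hzU : z + unitNormal ρ z * y ∉ U := fun hc =>
            lt_asymm hpos ((h.mem_iff _ hmemr).mp hc)
          filter_upwards [hζ.eventually (Metric.isOpen_ball.mem_nhds hmemr),
            ((h.differentiableAt _ hmemr).continuousAt.tendsto.comp hζ).eventually
              (Ioi_mem_nhds hpos)] with i hi1 hi2
          have : x i + unitNormal ρ (x i) * y ∉ U := fun hc =>
            lt_asymm hi2 ((h.mem_iff _ hi1).mp hc)
          simp [this, hzU]
      have hlim : Tendsto (fun i => (U.indicator 1 (z + unitNormal ρ z * y) -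
          {v : ℂ | v.re < 0}.indicator 1 y) * conjKernel (y + d i)) l
          (𝓝 (cuspIntegrand U R z (unitNormal ρ z) 0 y)) := by
        rw [cuspIntegrand, indicator_of_mem (show y ∈ {y : ℂ | ‖y + (0 : ℝ)‖ < R} by simpa using hlt),
          Complex.ofReal_zero, add_zero]
        exact ((continuousAt_conjKernel hy0).tendsto.comp hyd).const_mul _
      refine hlim.congr' ?_
      filter_upwards [hind, hyd.norm.eventually (Iio_mem_nhds hlt)] with i hi1 hi2
      rw [cuspIntegrand, indicator_of_mem (show y ∈ {y : ℂ | ‖y + d i‖ < R} from hi2), hi1]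
    · have hz : cuspIntegrand U R z (unitNormal ρ z) 0 y = 0 :=
        indicator_of_notMem (by simpa using hgt.le) _
      rw [hz]
      refine tendsto_const_nhds.congr' ?_
      filter_upwards [hyd.norm.eventually (Ioi_mem_nhds hgt)] with i hi
      exact (indicator_of_notMem (show y ∉ {y : ℂ | ‖y + d i‖ < R} from fun hc => lt_asymm hi hc) _).symm

/-- The principal value of the kernel over `U` exists at the boundary point `z`, and has a limit
there from within `U`. -/
theorem exists_oneSided_limit (h : IsLocalDefiningFunction γ U z r ρ K) (hU : IsOpen U)
    (hγ : 0 < γ) (hγ₁ : γ ≤ 1) :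
    ∃ R₀ > 0, ∀ R, 0 < R → R ≤ R₀ → ∃ (A : ℂ) (T : ℂ → ℂ),
      Tendsto (fun ε => annulusTransform U R ε z) (𝓝[>] 0) (𝓝 A) ∧
      (∀ᶠ w in 𝓝[U] z, Tendsto (fun ε => annulusTransform U R ε w) (𝓝[>] 0) (𝓝 (T w))) ∧
      Tendsto T (𝓝[U] z) (𝓝 (A + unitNormal ρ z ^ 2 * stripConst)) := by
  obtain ⟨δ, C, hδ, hδr, hC, hN, hcusp⟩ := h.exists_cusp hγ
  obtain ⟨δ₁, hδ₁, -, hnull⟩ := h.exists_volume_zero hγ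
  have hγ' : (0 : ℝ) < γ := by exact_mod_cast hγ
  have hγ₁' : (γ : ℝ) ≤ 1 := by exact_mod_cast hγ₁
  have hsmall : ∀ᶠ R : ℝ in 𝓝 0, C * (2 * R) ^ (γ : ℝ) < 1 / 2 := by
    have hc : ContinuousAt (fun R : ℝ => C * (2 * R) ^ (γ : ℝ)) 0 := by
      refine continuousAt_const.mul (ContinuousAt.rpow_const (by fun_prop) (Or.inr hγ'.le))
    exact hc.eventually_lt_const (by simp [Real.zero_rpow hγ'.ne'])
  obtain ⟨R₁, hR₁, hR₁s⟩ := Metric.eventually_nhds_iff_ball.mp hsmall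
  -- The three bounds secure, in turn, smallness of C(2R)^γ, validity of the cusp description up to
  -- radius 2R, and nullity of the zero set there.
  refine ⟨min (R₁ / 2) (min (δ / 2) (δ₁ / 2)), by positivity, fun R hR hRR => ?_⟩
  have hb1 : R < R₁ := by linarith [min_le_left (R₁ / 2) (min (δ / 2) (δ₁ / 2))]
  have hb2 : 2 * R ≤ δ := by
    linarith [min_le_right (R₁ / 2) (min (δ / 2) (δ₁ / 2)), min_le_left (δ / 2) (δ₁ / 2)]
  have hb3 : 2 * R ≤ δ₁ := by
    linarith [min_le_right (R₁ / 2) (min (δ / 2) (δ₁ / 2)), min_le_right (δ / 2) (δ₁ / 2)]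
  have hCR : C * (2 * R) ^ (γ : ℝ) ≤ 1 / 2 :=
    (hR₁s R (by simpa [abs_of_pos hR] using hb1)).le
  have hcusp' : ∀ x ∈ Metric.ball z δ, ρ x = 0 → ∀ y : ℂ, ‖y‖ < 2 * R →
      C * ‖y‖ ^ (1 + (γ : ℝ)) < |y.re| → (x + unitNormal ρ x * y ∈ U ↔ y.re < 0) :=
    fun x hx hρ y hy => hcusp x hx hρ y (hy.trans_le hb2)
  have hnull' : volume {x ∈ Metric.ball z (2 * R) | ρ x = 0} = 0 := by
    refine measure_mono_null ?_ hnull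
    intro x hx
    exact ⟨Metric.ball_subset_ball hb3 hx.1, hx.2⟩
  have hzδ : z ∈ Metric.ball z δ := Metric.mem_ball_self hδ
  have hzU : z ∉ U := by
    rw [h.mem_iff z (Metric.mem_ball_self h.pos), h.map_center]; exact lt_irrefl _
  have hfoot : ∀ w, ∃ (x : ℂ) (d : ℝ), w ∈ U → 2 * ‖w - z‖ < δ →
      0 < d ∧ d ≤ ‖w - z‖ ∧ ‖x - z‖ ≤ 2 * ‖w - z‖ ∧ ρ x = 0 ∧
      w = x - d * unitNormal ρ x ∧ Metric.ball w d ⊆ U := by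
    intro w
    by_cases hw : w ∈ U ∧ 2 * ‖w - z‖ < δ
    · obtain ⟨x, d, hxd⟩ := h.exists_foot hU hδr hN hw.1 hw.2
      exact ⟨x, d, fun _ _ => hxd⟩
    · exact ⟨0, 0, fun h1 h2 => absurd ⟨h1, h2⟩ hw⟩
  choose x d hxd using hfoot
  have hnorm : Tendsto (fun w => ‖w - z‖) (𝓝[U] z) (𝓝 0) := by
    have : Continuous fun w => ‖w - z‖ := by fun_prop
    simpa using (this.tendsto z).mono_left nhdsWithin_le_nhds
  have hev : ∀ᶠ w in 𝓝[U] z, (0 < d w ∧ d w ≤ ‖w - z‖ ∧ ‖x w - z‖ ≤ 2 * ‖w - z‖ ∧ ρ (x w) = 0 ∧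
      w = x w - d w * unitNormal ρ (x w) ∧ Metric.ball w (d w) ⊆ U) ∧ 2 * ‖w - z‖ < δ ∧
      ‖w - z‖ < R := by
    filter_upwards [self_mem_nhdsWithin, hnorm.eventually (Iio_mem_nhds (half_pos hδ)),
      hnorm.eventually (Iio_mem_nhds hR)] with w hw hwδ hwR
    have h2 : 2 * ‖w - z‖ < δ := by
      have : ‖w - z‖ < δ / 2 := hwδ
      linarith
    exact ⟨hxd w hw h2, h2, hwR⟩
  have hd : Tendsto d (𝓝[U] z) (𝓝 0) :=
    squeeze_zero' (hev.mono fun w hw => hw.1.1.le) (hev.mono fun w hw => hw.1.2.1) hnorm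
  have hd' : Tendsto d (𝓝[U] z) (𝓝[>] 0) :=
    tendsto_nhdsWithin_iff.mpr ⟨hd, hev.mono fun w hw => hw.1.1⟩
  have hx : Tendsto x (𝓝[U] z) (𝓝 z) := by
    rw [tendsto_iff_norm_sub_tendsto_zero]
    exact squeeze_zero' (Eventually.of_forall fun w => norm_nonneg _)
      (hev.mono fun w hw => hw.1.2.2.1) (by simpa using hnorm.const_mul 2)
  refine ⟨unitNormal ρ z ^ 2 * ∫ y, cuspIntegrand U R z (unitNormal ρ z) 0 y,
    fun w => unitNormal ρ (x w) ^ 2 * ((∫ y, cuspIntegrand U R (x w) (unitNormal ρ (x w)) (d w) y) +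
      ∫ u in annulus (d w) R, (strip (d w)).indicator 1 u * conjKernel u), ?_, ?_, ?_⟩
  · exact tendsto_annulusTransform_center hU.measurableSet hC hγ' hγ₁' hR hCR
      (norm_unitNormal (hN z hzδ)) hzU (hcusp' z hzδ h.map_center)
  · filter_upwards [hev] with w ⟨⟨h1, h2, h3, h4, h5, h6⟩, h7, h8⟩
    refine tendsto_const_nhds.congr' ?_
    filter_upwards [self_mem_nhdsWithin, nhdsWithin_le_nhds (Iio_mem_nhds h1)] with ε hε hεd
    refine (annulusTransform_of_foot hU.measurableSet hε (mem_Iio.mp hεd).le (h2.trans h8.le)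
      (norm_unitNormal (hN _ ?_)) h5 h6).symm
    rw [Metric.mem_ball, dist_eq_norm]
    linarith
  · rw [← mul_add]
    refine (((h.continuousAt_unitNormal hγ).tendsto.comp hx).pow 2).mul (Tendsto.add ?_ ?_)
    · exact h.tendsto_integral_cuspIntegrand hU hγ hγ₁ hδ hC hR (hb2.trans (by linarith)) hnull' hCR
        (hN z hzδ) hcusp' hx hd (hev.mono fun w hw => hw.1.2.2.2.1) (hev.mono fun w hw => hw.1.1.le)
    · exact (tendsto_setIntegral_strip hR).comp hd'

end IsLocalDefiningFunction

/-! ### The regularised Hölder terms. -/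

theorem tendsto_setIntegral_annulus {f : ℂ → ℂ} {R : ℝ}
    (hf : IntegrableOn f (Metric.ball 0 R)) :
    Tendsto (fun ε => ∫ u in annulus ε R, f u) (𝓝[>] 0) (𝓝 (∫ u in Metric.ball 0 R, f u)) := by
  have hb := (integrable_indicator_iff measurableSet_ball).mpr hf
  have heq : ∀ ε, ∫ u in annulus ε R, f u =
      ∫ u, {u : ℂ | ε ≤ ‖u‖}.indicator ((Metric.ball 0 R).indicator f) u := by
    intro ε
    rw [← integral_indicator (measurableSet_annulus ε R), indicator_indicator]
    congr 2 with u
    congr! 1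
    ext v
    simp [annulus]
  simp_rw [heq]
  rw [← integral_indicator measurableSet_ball]
  refine tendsto_integral_filter_of_dominated_convergence _ ?_ ?_ hb.norm ?_
  · exact Eventually.of_forall fun ε => hb.aestronglyMeasurable.indicator
      (measurableSet_le measurable_const measurable_norm)
  · exact Eventually.of_forall fun ε => Eventually.of_forall fun u => norm_indicator_le_norm_self _ _
  · have h0 : ∀ᵐ y : ℂ, y ≠ 0 := by rw [ae_iff]; simp
    filter_upwards [h0] with y hy
    refine tendsto_const_nhds.congr' ?_
    filter_upwards [nhdsWithin_le_nhds (Iio_mem_nhds (norm_pos_iff.mpr hy))] with ε hε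
    rw [indicator_of_mem (show y ∈ {y : ℂ | ε ≤ ‖y‖} from (mem_Iio.mp hε).le)]

/-- The regularised kernel integral of `f` over the part of `s` in the disc of radius `R`. -/
noncomputable def holderPart (f : ℂ → ℂ) (s : Set ℂ) (R : ℝ) (w : ℂ) : ℂ :=
  ∫ u in Metric.ball 0 R, (f (w + u) - f w) * s.indicator 1 (w + u) * conjKernel u

section Holder

variable {f : ℂ → ℂ} {s : Set ℂ} {γ D : ℝ}

theorem continuous_of_norm_sub_le_rpow (hγ : 0 < γ)
    (hf : ∀ x y, ‖f x - f y‖ ≤ D * ‖x - y‖ ^ γ) : Continuous f := by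
  refine continuous_iff_continuousAt.mpr fun x => ?_
  rw [ContinuousAt, tendsto_iff_norm_sub_tendsto_zero]
  have h : Tendsto (fun y => D * ‖y - x‖ ^ γ) (𝓝 x) (𝓝 0) := by
    have : Continuous fun y => D * ‖y - x‖ ^ γ :=
      continuous_const.mul (Continuous.rpow_const (by fun_prop) fun _ => Or.inr hγ.le)
    simpa [Real.zero_rpow hγ.ne'] using this.tendsto x
  exact squeeze_zero (fun _ => norm_nonneg _) (fun y => hf y x) h

theorem norm_holder_integrand_le (hf : ∀ x y, ‖f x - f y‖ ≤ D * ‖x - y‖ ^ γ) (w u : ℂ) :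
    ‖(f (w + u) - f w) * s.indicator 1 (w + u) * conjKernel u‖ ≤
      D * (‖u‖ ^ γ * (‖u‖ ^ 2)⁻¹) := by
  rw [norm_mul, norm_mul, norm_conjKernel, ← mul_assoc]
  have h1 := hf (w + u) w
  rw [add_sub_cancel_left] at h1
  have h2 : ‖(s.indicator 1 (w + u) : ℂ)‖ ≤ 1 :=
    (norm_indicator_le_norm_self _ _).trans (by simp)
  refine mul_le_mul_of_nonneg_right ?_ (by positivity)
  calc _ ≤ ‖f (w + u) - f w‖ * 1 := mul_le_mul_of_nonneg_left h2 (norm_nonneg _)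
    _ ≤ _ := by rwa [mul_one]

theorem aestronglyMeasurable_holder_integrand (hfc : Continuous f) (hs : MeasurableSet s) (w : ℂ)
    (μ : Measure ℂ) :
    AEStronglyMeasurable (fun u => (f (w + u) - f w) * s.indicator 1 (w + u) * conjKernel u) μ := by
  refine Measurable.aestronglyMeasurable (Measurable.mul (Measurable.mul ?_ ?_) measurable_conjKernel)
  · exact (Continuous.measurable (by fun_prop))
  · exact (measurable_one.indicator hs).comp (measurable_const_add w)

theorem integrableOn_ball_rpow (hγ : 0 < γ) (hγ₁ : γ ≤ 1) (D R : ℝ) :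
    IntegrableOn (fun u : ℂ => D * (‖u‖ ^ γ * (‖u‖ ^ 2)⁻¹)) (Metric.ball 0 R) :=
  Integrable.const_mul ((integrable_indicator_iff measurableSet_ball).mp
    (integrable_indicator_norm_rpow hγ hγ₁ R)) D

theorem integrableOn_holder_integrand (hγ : 0 < γ) (hγ₁ : γ ≤ 1)
    (hf : ∀ x y, ‖f x - f y‖ ≤ D * ‖x - y‖ ^ γ) (hs : MeasurableSet s) (R : ℝ) (w : ℂ) :
    IntegrableOn (fun u => (f (w + u) - f w) * s.indicator 1 (w + u) * conjKernel u)
      (Metric.ball 0 R) :=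
  (integrableOn_ball_rpow hγ hγ₁ D R).mono'
    (aestronglyMeasurable_holder_integrand (continuous_of_norm_sub_le_rpow hγ hf) hs w _)
    (Eventually.of_forall fun u => norm_holder_integrand_le hf w u)

theorem ae_add_notMem {E : Set ℂ} (hE : volume E = 0) (w : ℂ) : ∀ᵐ u : ℂ, w + u ∉ E :=
  (measurePreserving_add_left volume w).quasiMeasurePreserving.ae
    (measure_eq_zero_iff_ae_notMem.mp hE)

/-- The majorant D|u|^{γ-2} does not depend on w, and for almost every u the point z + u is off the
frontier, where the indicator is locally constant. -/
theorem continuous_holderPart (hγ : 0 < γ) (hγ₁ : γ ≤ 1)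
    (hf : ∀ x y, ‖f x - f y‖ ≤ D * ‖x - y‖ ^ γ) (hs : IsOpen s) (hs0 : volume (frontier s) = 0)
    (R : ℝ) : Continuous (holderPart f s R) := by
  have hfc := continuous_of_norm_sub_le_rpow hγ hf
  refine continuous_iff_continuousAt.mpr fun z => ?_
  refine tendsto_integral_filter_of_dominated_convergence _ ?_ ?_
    (integrableOn_ball_rpow hγ hγ₁ D R) ?_
  · exact Eventually.of_forall fun w =>
      aestronglyMeasurable_holder_integrand hfc hs.measurableSet w _
  · exact Eventually.of_forall fun w => Eventually.of_forall fun u =>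
      norm_holder_integrand_le hf w u
  · refine ae_restrict_of_ae ?_
    filter_upwards [ae_add_notMem hs0 z] with u hu
    have hc : Continuous fun w => f (w + u) - f w := by fun_prop
    have ha : Tendsto (fun w : ℂ => w + u) (𝓝 z) (𝓝 (z + u)) :=
      (continuous_add_const u).tendsto z
    have hi : Tendsto (fun w => (s.indicator 1 (w + u) : ℂ)) (𝓝 z) (𝓝 (s.indicator 1 (z + u))) := by
      refine tendsto_const_nhds.congr' ?_
      by_cases hzs : z + u ∈ s
      · filter_upwards [ha (hs.mem_nhds hzs)] with w hw
        rw [indicator_of_mem hzs, indicator_of_mem (show w + u ∈ s from hw)]; rfl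
      · have hzc : z + u ∉ closure s := fun hc => hu ⟨hc, fun hint => hzs (interior_subset hint)⟩
        filter_upwards [ha (isClosed_closure.isOpen_compl.mem_nhds hzc)] with w hw
        rw [indicator_of_notMem hzs,
          indicator_of_notMem (show w + u ∉ s from fun h => hw (subset_closure h))]
    exact ((hc.tendsto z).mul hi).mul_const _

theorem tendsto_holderPart (hγ : 0 < γ) (hγ₁ : γ ≤ 1)
    (hf : ∀ x y, ‖f x - f y‖ ≤ D * ‖x - y‖ ^ γ) (hs : MeasurableSet s) (R : ℝ) (w : ℂ) :
    Tendsto (fun ε => ∫ u in annulus ε R,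
      (f (w + u) - f w) * s.indicator 1 (w + u) * conjKernel u) (𝓝[>] 0)
      (𝓝 (holderPart f s R w)) :=
  tendsto_setIntegral_annulus (integrableOn_holder_integrand hγ hγ₁ hf hs R w)

end Holder

/-! ### The far part of the transform. -/

section Far

variable {g : ℂ → ℂ} {p : ℝ≥0∞}

theorem conjBeurlingIntegrand_eq (g : ℂ → ℂ) (w ζ : ℂ) :
    conjBeurlingIntegrand g w ζ = g ζ * conjKernel (ζ - w) := by
  rw [conjBeurlingIntegrand, conjKernel, map_sub, div_eq_mul_inv]

/-- Hölder's inequality: the weight lies in L^q of the plane because 2q > 2, that is q > 1, which is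
where p < ∞ enters. -/
theorem integrable_norm_mul_japanese (hp₁ : 1 < p) (hp : p ≠ ∞) (hg : MemLp g p) (z : ℂ) :
    Integrable fun ζ => ‖g ζ‖ * ((1 + ‖ζ - z‖) ^ 2)⁻¹ := by
  have hpq := ENNReal.HolderConjugate.conjExponent hp₁.le
  set q := p.conjExponent with hq
  have hq1 : 1 < q := ENNReal.HolderConjugate.lt_top_iff_one_lt p q |>.mp hp.lt_top
  have hqtop : q ≠ ∞ := (ENNReal.HolderConjugate.lt_top_iff_one_lt q p |>.mpr hp₁).ne
  have hq1' : 1 < q.toReal := by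
    rw [← ENNReal.toReal_one]
    exact (ENNReal.toReal_lt_toReal ENNReal.one_ne_top hqtop).mpr hq1
  have hJ : MemLp (fun ζ : ℂ => ((1 + ‖ζ - z‖) ^ 2)⁻¹) q := by
    have hm : AEStronglyMeasurable (fun ζ : ℂ => ((1 + ‖ζ - z‖) ^ 2)⁻¹) volume :=
      Measurable.aestronglyMeasurable (by fun_prop)
    rw [← integrable_norm_rpow_iff hm (zero_lt_one.trans hq1).ne' hqtop]
    have h := (integrable_one_add_norm (E := ℂ) (μ := volume) (r := 2 * q.toReal)
      (by rw [Complex.finrank_real_complex]; push_cast; linarith)).comp_sub_right z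
    refine h.congr (Eventually.of_forall fun ζ => ?_)
    have h0 : 0 < 1 + ‖ζ - z‖ := by positivity
    simp only
    rw [Real.norm_of_nonneg (by positivity), ← Real.rpow_natCast, ← Real.rpow_neg h0.le,
      ← Real.rpow_mul h0.le]
    congr 1
    push_cast
    ring
  exact hg.norm.integrable_mul hJ

theorem norm_far_integrand_le {R : ℝ} (hR : 0 < R) {z w : ℂ} (hw : ‖w - z‖ ≤ R / 2) (ζ : ℂ) :
    ‖(Metric.ball w R)ᶜ.indicator (conjBeurlingIntegrand g w) ζ‖ ≤
      (1 / R + 3 / 2) ^ 2 * (‖g ζ‖ * ((1 + ‖ζ - z‖) ^ 2)⁻¹) := by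
  by_cases hζ : ζ ∈ (Metric.ball w R)ᶜ
  · rw [indicator_of_mem hζ, conjBeurlingIntegrand_eq, norm_mul, norm_conjKernel]
    have h1 : R ≤ ‖ζ - w‖ := by simpa [dist_eq_norm] using hζ
    have h0 : 0 < ‖ζ - w‖ := hR.trans_le h1
    have h2 : ‖ζ - z‖ ≤ ‖ζ - w‖ + R / 2 := by
      calc ‖ζ - z‖ = ‖(ζ - w) + (w - z)‖ := by ring_nf
        _ ≤ _ := (norm_add_le _ _).trans (by linarith)
    have h3 : 1 + ‖ζ - z‖ ≤ (1 / R + 3 / 2) * ‖ζ - w‖ := by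
      have : 1 ≤ 1 / R * ‖ζ - w‖ := by
        rw [one_div, ← div_eq_inv_mul, one_le_div hR]; exact h1
      linarith
    have h4 : (‖ζ - w‖ ^ 2)⁻¹ ≤ (1 / R + 3 / 2) ^ 2 * ((1 + ‖ζ - z‖) ^ 2)⁻¹ := by
      rw [← div_eq_mul_inv, le_div_iff₀ (by positivity), inv_mul_le_iff₀ (by positivity), mul_comm,
        ← mul_pow]
      gcongr
    calc _ ≤ ‖g ζ‖ * ((1 / R + 3 / 2) ^ 2 * ((1 + ‖ζ - z‖) ^ 2)⁻¹) := by gcongr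
      _ = _ := by ring
  · rw [indicator_of_notMem hζ, norm_zero]; positivity

theorem aestronglyMeasurable_conjBeurlingIntegrand (hg : AEStronglyMeasurable g) (w : ℂ) :
    AEStronglyMeasurable (conjBeurlingIntegrand g w) := by
  have : conjBeurlingIntegrand g w = fun ζ => g ζ * conjKernel (ζ - w) :=
    funext (conjBeurlingIntegrand_eq g w)
  rw [this]
  exact hg.mul (measurable_conjKernel.comp (measurable_sub_const w)).aestronglyMeasurable

theorem integrableOn_conjBeurlingIntegrand (hp₁ : 1 < p) (hp : p ≠ ∞) (hg : MemLp g p) {R : ℝ}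
    (hR : 0 < R) (w : ℂ) : IntegrableOn (conjBeurlingIntegrand g w) (Metric.ball w R)ᶜ := by
  rw [← integrable_indicator_iff measurableSet_ball.compl]
  refine ((integrable_norm_mul_japanese hp₁ hp hg w).const_mul ((1 / R + 3 / 2) ^ 2)).mono'
    ((aestronglyMeasurable_conjBeurlingIntegrand hg.1 w).indicator measurableSet_ball.compl)
    (Eventually.of_forall fun ζ => norm_far_integrand_le hR (by simpa using (half_pos hR).le) ζ)

theorem continuous_truncConjBeurling (hp₁ : 1 < p) (hp : p ≠ ∞) (hg : MemLp g p) {R : ℝ}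
    (hR : 0 < R) : Continuous (truncConjBeurling g R) := by
  refine continuous_iff_continuousAt.mpr fun z => ?_
  have heq : truncConjBeurling g R =
      fun w => ∫ ζ, (Metric.ball w R)ᶜ.indicator (conjBeurlingIntegrand g w) ζ := by
    ext w
    rw [truncConjBeurling, integral_indicator measurableSet_ball.compl]
  rw [heq]
  refine tendsto_integral_filter_of_dominated_convergence _ ?_ ?_
    ((integrable_norm_mul_japanese hp₁ hp hg z).const_mul ((1 / R + 3 / 2) ^ 2)) ?_
  · exact Eventually.of_forall fun w =>
      (aestronglyMeasurable_conjBeurlingIntegrand hg.1 w).indicator measurableSet_ball.compl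
  · filter_upwards [Metric.closedBall_mem_nhds z (half_pos hR)] with w hw
    rw [mem_closedBall_iff_norm] at hw
    exact Eventually.of_forall fun ζ => norm_far_integrand_le hR hw ζ
  · have h1 : ∀ᵐ ζ : ℂ, ζ ∉ Metric.sphere z R :=
      measure_eq_zero_iff_ae_notMem.mp (Measure.addHaar_sphere volume z R)
    filter_upwards [h1] with ζ hζ
    have hζ' : ‖ζ - z‖ ≠ R := by simpa [dist_eq_norm] using hζ
    have hc : Tendsto (fun w => ζ - w) (𝓝 z) (𝓝 (ζ - z)) :=
      (continuous_const.sub continuous_id).tendsto z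
    rcases lt_or_gt_of_ne hζ' with hlt | hgt
    · rw [indicator_of_notMem (by simpa [dist_eq_norm] using hlt)]
      refine tendsto_const_nhds.congr' ?_
      filter_upwards [hc.norm.eventually (Iio_mem_nhds hlt)] with w hw
      have hw' : ‖ζ - w‖ < R := hw
      rw [indicator_of_notMem (by simpa [dist_eq_norm] using hw')]
    · rw [indicator_of_mem (by simpa [dist_eq_norm] using hgt.le), conjBeurlingIntegrand_eq]
      have h0 : ζ - z ≠ 0 := norm_pos_iff.mp (hR.trans hgt)
      refine Tendsto.congr' ?_ (((continuousAt_conjKernel h0).tendsto.comp hc).const_mul (g ζ))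
      filter_upwards [hc.norm.eventually (Ioi_mem_nhds hgt)] with w hw
      have hw' : R < ‖ζ - w‖ := hw
      rw [indicator_of_mem (by simpa [dist_eq_norm] using hw'.le), conjBeurlingIntegrand_eq]
      rfl

theorem truncConjBeurling_eq_add (hp₁ : 1 < p) (hp : p ≠ ∞) (hg : MemLp g p) {ε R : ℝ}
    (hε : 0 < ε) (hεR : ε ≤ R) (w : ℂ) :
    truncConjBeurling g ε w =
      truncConjBeurling g R w + ∫ u in annulus ε R, g (w + u) * conjKernel u := by
  have hsub : (Metric.ball w R)ᶜ ⊆ (Metric.ball w ε)ᶜ :=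
    compl_subset_compl.mpr (Metric.ball_subset_ball hεR)
  have hint := integrableOn_conjBeurlingIntegrand hp₁ hp hg hε w
  have h1 := setIntegral_union (μ := volume) (f := conjBeurlingIntegrand g w)
    (disjoint_sdiff_right (s := (Metric.ball w R)ᶜ) (t := (Metric.ball w ε)ᶜ))
    (measurableSet_ball.compl.diff measurableSet_ball.compl)
    (hint.mono_set hsub) (hint.mono_set sdiff_subset)
  rw [union_sdiff_cancel hsub] at h1
  rw [truncConjBeurling, truncConjBeurling, h1]
  congr 1
  rw [← integral_indicator (measurableSet_ball.compl.diff measurableSet_ball.compl),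
    ← integral_indicator (measurableSet_annulus ε R), ← integral_add_left_eq_self _ w]
  congr 1 with u
  by_cases h2 : ε ≤ ‖u‖ <;> by_cases h3 : ‖u‖ < R <;>
    simp [indicator, annulus, h2, h3, conjBeurlingIntegrand_eq]

end Far

/-! ### Assembly: reduction to the indicator, and the jump relation. -/

/-- If the principal value of the kernel over `Ω` exists at `w`, so does the transform of a
piecewise Hölder function, and it is given by the regularised formula. -/
theorem hasConjBeurling_of_tendsto {γ D D' : ℝ} (hγ : 0 < γ) (hγ₁ : γ ≤ 1) {Ω : Set ℂ}
    (hΩo : IsOpen Ω) (hΩ0 : volume (frontier Ω) = 0) {g f h : ℂ → ℂ}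
    (hf : ∀ x y, ‖f x - f y‖ ≤ D * ‖x - y‖ ^ γ) (hh : ∀ x y, ‖h x - h y‖ ≤ D' * ‖x - y‖ ^ γ)
    (hgfh : ∀ ζ ∉ frontier Ω, g ζ = f ζ + h ζ * Ω.indicator 1 ζ)
    {p : ℝ≥0∞} (hp₁ : 1 < p) (hp : p ≠ ∞) (hg : MemLp g p) {R : ℝ} (hR : 0 < R) {w A : ℂ}
    (hA : Tendsto (fun ε => annulusTransform Ω R ε w) (𝓝[>] 0) (𝓝 A)) :
    HasConjBeurling g w
      (truncConjBeurling g R w + (holderPart f univ R w + holderPart h Ω R w + h w * A)) := by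
  refine ⟨fun ε hε => integrableOn_conjBeurlingIntegrand hp₁ hp hg hε w, ?_⟩
  refine Tendsto.congr' ?_ (tendsto_const_nhds.add
    (((tendsto_holderPart hγ hγ₁ hf MeasurableSet.univ R w).add
      (tendsto_holderPart hγ hγ₁ hh hΩo.measurableSet R w)).add (hA.const_mul (h w))))
  filter_upwards [self_mem_nhdsWithin, nhdsWithin_le_nhds (Iio_mem_nhds hR)] with ε hε hεR
  have hε' : 0 < ε := hε
  rw [truncConjBeurling_eq_add hp₁ hp hg hε' (mem_Iio.mp hεR).le]
  congr 1
  have hsub : annulus ε R ⊆ Metric.ball 0 R := fun u hu => by simpa using hu.2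
  have i1 := (integrableOn_holder_integrand hγ hγ₁ hf MeasurableSet.univ R w).mono_set hsub
  have i2 := (integrableOn_holder_integrand hγ hγ₁ hh hΩo.measurableSet R w).mono_set hsub
  have i3 : IntegrableOn (fun u => Ω.indicator 1 (w + u) * conjKernel u) (annulus ε R) :=
    integrableOn_annulus_mul_conjKernel (M := 1) hε'
      ((measurable_one.indicator hΩo.measurableSet).comp
        (measurable_const_add w)).aestronglyMeasurable
      fun u _ => (norm_indicator_le_norm_self _ _).trans (by simp)
  have i4 : IntegrableOn conjKernel (annulus ε R) := by
    simpa using integrableOn_annulus_indicator hε' R MeasurableSet.univ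
  -- The subtracted constant f(w) costs nothing; h(w) survives because it multiplies the indicator
  -- of Ω.
  have hzero : ∫ u in annulus ε R, f w * conjKernel u = 0 := by
    rw [integral_const_mul, setIntegral_annulus_conjKernel, mul_zero]
  have i12 : IntegrableOn (fun u => (f (w + u) - f w) * univ.indicator 1 (w + u) * conjKernel u +
      (h (w + u) - h w) * Ω.indicator 1 (w + u) * conjKernel u) (annulus ε R) := i1.add i2
  have i123 : IntegrableOn (fun u => (f (w + u) - f w) * univ.indicator 1 (w + u) * conjKernel u +
      (h (w + u) - h w) * Ω.indicator 1 (w + u) * conjKernel u +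
      h w * (Ω.indicator 1 (w + u) * conjKernel u)) (annulus ε R) := i12.add (i3.const_mul (h w))
  rw [annulusTransform, ← integral_const_mul, ← integral_add i1 i2,
    ← integral_add i12 (i3.const_mul (h w)), ← add_zero (∫ u in annulus ε R, _), ← hzero,
    ← integral_add i123 (i4.const_mul (f w))]
  refine integral_congr_ae (ae_restrict_of_ae ?_)
  filter_upwards [ae_add_notMem hΩ0 w] with u hu
  simp only [indicator_univ, Pi.one_apply]
  rw [hgfh _ hu]
  ring

/-- Where the indicator of `U` is locally constant, the annulus integrals converge. -/
theorem exists_tendsto_annulusTransform {U : Set ℂ} (hU : MeasurableSet U) {R : ℝ} (hR : 0 < R)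
    {w c : ℂ} (hc : ∀ᶠ ζ in 𝓝 w, (U.indicator 1 ζ : ℂ) = c) :
    ∃ A, Tendsto (fun ε => annulusTransform U R ε w) (𝓝[>] 0) (𝓝 A) := by
  obtain ⟨δ, hδ, hδc⟩ := Metric.eventually_nhds_iff_ball.mp hc
  have hm : 0 < min δ R := lt_min hδ hR
  refine ⟨annulusTransform U R (min δ R) w, tendsto_const_nhds.congr' ?_⟩
  filter_upwards [self_mem_nhdsWithin, nhdsWithin_le_nhds (Iio_mem_nhds hm)] with ε hε hεm
  have i3 : IntegrableOn (fun u => U.indicator 1 (w + u) * conjKernel u) (annulus ε R) :=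
    integrableOn_annulus_mul_conjKernel (M := 1) hε
      ((measurable_one.indicator hU).comp (measurable_const_add w)).aestronglyMeasurable
      fun u _ => (norm_indicator_le_norm_self _ _).trans (by simp)
  have h0 : ∫ u in annulus ε (min δ R), U.indicator 1 (w + u) * conjKernel u = 0 := by
    have : ∫ u in annulus ε (min δ R), c * conjKernel u = 0 := by
      rw [integral_const_mul, setIntegral_annulus_conjKernel, mul_zero]
    rw [← this]
    refine setIntegral_congr_fun (measurableSet_annulus _ _) fun u hu => ?_
    have : (U.indicator 1 (w + u) : ℂ) = c := hδc _ ?_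
    · rw [this]
    rw [Metric.mem_ball, dist_eq_norm, add_sub_cancel_left]
    exact hu.2.trans_le (min_le_left _ _)
  rw [annulusTransform, annulusTransform,
    setIntegral_annulus_split (mem_Iio.mp hεm).le (min_le_right _ _) i3, h0, zero_add]

/-- The domain and its exterior fill the plane up to the null frontier, and the full annulus
integral is zero. -/
theorem annulusTransform_compl_closure {Ω : Set ℂ} (hΩo : IsOpen Ω)
    (hΩ0 : volume (frontier Ω) = 0) {R ε : ℝ} (hε : 0 < ε) (w : ℂ) :
    annulusTransform Ω R ε w = -annulusTransform (closure Ω)ᶜ R ε w := by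
  have hi : ∀ {U : Set ℂ}, MeasurableSet U →
      IntegrableOn (fun u => U.indicator 1 (w + u) * conjKernel u) (annulus ε R) := fun hU =>
    integrableOn_annulus_mul_conjKernel (M := 1) hε
      ((measurable_one.indicator hU).comp (measurable_const_add w)).aestronglyMeasurable
      fun u _ => (norm_indicator_le_norm_self _ _).trans (by simp)
  rw [eq_neg_iff_add_eq_zero, annulusTransform, annulusTransform,
    ← integral_add (hi hΩo.measurableSet) (hi isClosed_closure.isOpen_compl.measurableSet),
    ← setIntegral_annulus_conjKernel ε R]
  refine integral_congr_ae (ae_restrict_of_ae ?_)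
  filter_upwards [ae_add_notMem hΩ0 w] with u hu
  by_cases hmem : w + u ∈ Ω
  · simp [hmem, subset_closure hmem]
  · have : w + u ∉ closure Ω := fun hc => hu ⟨hc, fun hint => hmem (interior_subset hint)⟩
    simp [hmem, this]

theorem HasConjBeurling.conjBeurling_eq {g : ℂ → ℂ} {w v : ℂ} (h : HasConjBeurling g w v) :
    conjBeurling g w = v :=
  h.2.limUnder_eq

/-- Locally `closure Ω` is {ρ ≤ 0}, so -ρ defines the exterior and both sides can be treated by the
same one-sided result. -/
theorem HasC1HolderBoundary.exists_isLocalDefiningFunction {γ : ℝ≥0} {Ω : Set ℂ}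
    (hΩ : HasC1HolderBoundary γ Ω) {z : ℂ} (hz : z ∈ frontier Ω) :
    ∃ (r : ℝ) (ρ : ℂ → ℝ) (K : ℝ≥0), IsLocalDefiningFunction γ Ω z r ρ K ∧
      IsLocalDefiningFunction γ (closure Ω)ᶜ z r (fun w => -ρ w) K ∧
      ∀ w ∈ Metric.ball z r, w ∈ frontier Ω ↔ ρ w = 0 := by
  obtain ⟨r, ρ, K, hr, hdiff, hhol, hne, hin, hfr⟩ := hΩ z hz
  have h : IsLocalDefiningFunction γ Ω z r ρ K :=
    ⟨hr, hdiff, hhol, hne, (hfr z (Metric.mem_ball_self hr)).mp hz, hin⟩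
  refine ⟨r, ρ, K, h, h.neg_of_mem_iff fun w hw => ?_, hfr⟩
  have h1 := hin w hw
  have h2 := hfr w hw
  rw [mem_compl_iff, closure_eq_self_union_frontier, mem_union, h1, h2, not_or, not_lt]
  exact ⟨fun ⟨a, b⟩ => lt_of_le_of_ne a (Ne.symm b), fun a => ⟨a.le, a.ne'⟩⟩

theorem HasC1HolderBoundary.volume_frontier {γ : ℝ≥0} (hγ : 0 < γ) {Ω : Set ℂ}
    (hΩ : HasC1HolderBoundary γ Ω) : volume (frontier Ω) = 0 := by
  refine measure_null_of_locally_null _ fun z hz => ?_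
  obtain ⟨r, ρ, K, h, -, hfr⟩ := hΩ.exists_isLocalDefiningFunction hz
  obtain ⟨δ, hδ, hδr, hnull⟩ := h.exists_volume_zero hγ
  refine ⟨_, ?_, hnull⟩
  filter_upwards [self_mem_nhdsWithin, nhdsWithin_le_nhds (Metric.ball_mem_nhds z hδ)] with w hw hwδ
  exact ⟨hwδ, (hfr w (Metric.ball_subset_ball hδr hwδ)).mp hw⟩

theorem mainTheorem1 (γ : ℝ≥0) (hγ₀ : 0 < γ) (hγ₁ : γ ≤ 1)
    (Ω : Set ℂ) (hΩo : IsOpen Ω) (hΩc : IsConnected Ω) (hΩb : Bornology.IsBounded Ω)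
    (hΩ : HasC1HolderBoundary γ Ω)
    (g gm gp : ℂ → ℂ) (Cm Cp : ℝ≥0)
    (hgm : HolderOnWith Cm γ gm (closure Ω)) (hgm' : EqOn g gm Ω)
    (hgp : HolderOnWith Cp γ gp Ωᶜ) (hgp' : EqOn g gp (closure Ω)ᶜ)
    (p : ℝ≥0∞) (hp₁ : 1 < p) (hp : p ≠ ∞) (hgLp : MemLp g p (volume : Measure ℂ)) :
    (∀ w : ℂ, HasConjBeurling g w (conjBeurling g w)) ∧
    ∀ z ∈ frontier Ω, ∃ a b : ℂ,
      Tendsto (conjBeurling g) (𝓝[Ω] z) (𝓝 a) ∧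
      Tendsto (conjBeurling g) (𝓝[(closure Ω)ᶜ] z) (𝓝 b) ∧
      conjBeurling g z = (1 / 2) * (a + b) := by
  have hγ₀' : (0 : ℝ) < γ := by exact_mod_cast hγ₀
  have hγ₁' : (γ : ℝ) ≤ 1 := by exact_mod_cast hγ₁
  have hV : IsOpen (closure Ω)ᶜ := isClosed_closure.isOpen_compl
  have hΩ0 := hΩ.volume_frontier hγ₀
  obtain ⟨fm, Dm, -, hfm, hfm'⟩ := hgm.exists_extension hγ₀ hγ₁
  obtain ⟨f, D, -, hf, hf'⟩ := hgp.exists_extension hγ₀ hγ₁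
  set h : ℂ → ℂ := fun ζ => fm ζ - f ζ with hdef
  have hh : ∀ x y, ‖h x - h y‖ ≤ (Dm + D) * ‖x - y‖ ^ (γ : ℝ) := fun x y => by
    calc ‖h x - h y‖ = ‖(fm x - fm y) - (f x - f y)‖ := by rw [hdef]; ring_nf
      _ ≤ ‖fm x - fm y‖ + ‖f x - f y‖ := norm_sub_le _ _
      _ ≤ _ := by linarith [hfm x y, hf x y]
  have hgfh : ∀ ζ ∉ frontier Ω, g ζ = f ζ + h ζ * Ω.indicator 1 ζ := by
    intro ζ hζ
    by_cases hmem : ζ ∈ Ω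
    · rw [hgm' hmem, hfm' (subset_closure hmem), indicator_of_mem hmem]
      simp [hdef]
    · have hc : ζ ∈ (closure Ω)ᶜ := fun hc => hζ ⟨hc, fun hint => hmem (interior_subset hint)⟩
      rw [hgp' hc, hf' (show ζ ∈ Ωᶜ from hmem), indicator_of_notMem hmem]
      simp
  have key : ∀ {R : ℝ}, 0 < R → ∀ {w A : ℂ},
      Tendsto (fun ε => annulusTransform Ω R ε w) (𝓝[>] 0) (𝓝 A) → HasConjBeurling g w
      (truncConjBeurling g R w + (holderPart f univ R w + holderPart h Ω R w + h w * A)) :=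
    fun hR => hasConjBeurling_of_tendsto hγ₀' hγ₁' hΩo hΩ0 hf hh hgfh hp₁ hp hgLp hR
  refine ⟨fun w => ?_, fun z hz => ?_⟩
  · suffices ∃ R > 0, ∃ A, Tendsto (fun ε => annulusTransform Ω R ε w) (𝓝[>] 0) (𝓝 A) by
      obtain ⟨R, hR, A, hA⟩ := this
      rw [(key hR hA).conjBeurling_eq]
      exact key hR hA
    by_cases hw : w ∈ frontier Ω
    · obtain ⟨r, ρ, K, hρ, -, -⟩ := hΩ.exists_isLocalDefiningFunction hw
      obtain ⟨R, hR, hlim⟩ := hρ.exists_oneSided_limit hΩo hγ₀ hγ₁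
      obtain ⟨A, -, hA, -⟩ := hlim R hR le_rfl
      exact ⟨R, hR, A, hA⟩
    · refine ⟨1, one_pos, ?_⟩
      by_cases hmem : w ∈ Ω
      · refine exists_tendsto_annulusTransform hΩo.measurableSet one_pos (c := 1) ?_
        filter_upwards [hΩo.mem_nhds hmem] with ζ hζ
        simp [hζ]
      · have hc : w ∈ (closure Ω)ᶜ := fun hc => hw ⟨hc, fun hint => hmem (interior_subset hint)⟩
        refine exists_tendsto_annulusTransform hΩo.measurableSet one_pos (c := 0) ?_
        filter_upwards [hV.mem_nhds hc] with ζ hζ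
        exact indicator_of_notMem (fun hζΩ => hζ (subset_closure hζΩ)) _
  · obtain ⟨r, ρ, K, hρ, hρ', -⟩ := hΩ.exists_isLocalDefiningFunction hz
    obtain ⟨R₁, hR₁, hlim₁⟩ := hρ.exists_oneSided_limit hΩo hγ₀ hγ₁
    obtain ⟨R₂, hR₂, hlim₂⟩ := hρ'.exists_oneSided_limit hV hγ₀ hγ₁
    have hR : 0 < min R₁ R₂ := lt_min hR₁ hR₂
    set R := min R₁ R₂
    obtain ⟨A, T, hA, hT, hTlim⟩ := hlim₁ R hR (min_le_left _ _)
    obtain ⟨A', T', hA', hT', hTlim'⟩ := hlim₂ R hR (min_le_right _ _)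
    -- Reversing the normal leaves its square unchanged, so both sides carry the same strip term;
    -- the sign change of the transform then makes the two terms opposite.
    rw [unitNormal_neg, neg_sq] at hTlim'
    have hflip : ∀ {w B : ℂ},
        Tendsto (fun ε => annulusTransform (closure Ω)ᶜ R ε w) (𝓝[>] 0) (𝓝 B) →
        Tendsto (fun ε => annulusTransform Ω R ε w) (𝓝[>] 0) (𝓝 (-B)) := by
      intro w B hB
      refine hB.neg.congr' ?_
      filter_upwards [self_mem_nhdsWithin] with ε hε
      exact (annulusTransform_compl_closure hΩo hΩ0 hε w).symm
    have hAA' : A' = -A := by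
      rw [tendsto_nhds_unique hA (hflip hA'), neg_neg]
    have hhc := continuous_of_norm_sub_le_rpow hγ₀' hh
    have hcont : Continuous fun w =>
        truncConjBeurling g R w + (holderPart f univ R w + holderPart h Ω R w) :=
      (continuous_truncConjBeurling hp₁ hp hgLp hR).add
        ((continuous_holderPart hγ₀' hγ₁' hf isOpen_univ (by simp) R).add
          (continuous_holderPart hγ₀' hγ₁' hh hΩo hΩ0 R))
    set S := fun w => truncConjBeurling g R w + (holderPart f univ R w + holderPart h Ω R w)
    have hlim : ∀ {s : Set ℂ} {τ : ℂ → ℂ} {L : ℂ},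
        (∀ᶠ w in 𝓝[s] z, Tendsto (fun ε => annulusTransform Ω R ε w) (𝓝[>] 0) (𝓝 (τ w))) →
        Tendsto τ (𝓝[s] z) (𝓝 L) → Tendsto (conjBeurling g) (𝓝[s] z) (𝓝 (S z + h z * L)) := by
      intro s τ L h1 h2
      refine Tendsto.congr' ?_ (((hcont.tendsto z).mono_left nhdsWithin_le_nhds).add
        (((hhc.tendsto z).mono_left nhdsWithin_le_nhds).mul h2))
      filter_upwards [h1] with w hw
      rw [(key hR hw).conjBeurling_eq]
      ring
    -- With `A' = -A` the two limits carry A ± n²·`stripConst` as factors of h(z), and the strip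
    -- terms cancel in the mean.
    refine ⟨_, _, hlim hT hTlim, hlim (hT'.mono fun w hw => hflip hw) hTlim'.neg, ?_⟩
    rw [(key hR hA).conjBeurling_eq, hAA']
    simp only [S]
    ring
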